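/- Let $S(2n)$ be the group of permutations of $\{-n,\dots,-1,1,\dots,n\}$ (permutations being multiplied from left to right), let $H(n)$ be the centralizer in $S(2n)$ of the product $(-n,n)\cdots(-1,1)$, and embed $S(2n)$ into $S(2n+2)$ as the subgroup fixing $\pm(n+1)$; put $S(2\infty)=\bigcup_n S(2n)$ and $H=\bigcup_n H(n)$. Let $X(n)$ be the set of partitions of $\{-n,\dots,-1,1,\dots,n\}$ into $n$ unordered pairs, with the right action $x\cdot g=\{\{g(i),g(j)\}:\{i,j\}\in x\}$ of $S(2n)$, and let $[x]_n$ be the number of cycles of $x\in X(n)$, that is, of connected components of the graph on $\{-n,\dots,-1,1,\dots,n\}$ whose edges are the pairs of $x$ and the pairs $\{i,-i\}$. Let $p_{n,n+1}:X(n+1)\to X(n)$ delete the pair $\{n+1,-n-1\}$ if it is present, and otherwise replace the pairs $\{i,-n-1\},\{j,n+1\}$ by $\{i,j\}$. Let $X=\varprojlim X(n)$, with projections $p_n:X\to X(n)$ and the induced right action of $S(2\infty)$. For $t>0$ let $$\mu_t^{(n)}(x)=\frac{t^{[x]_n}}{t(t+2)\cdots(t+2n-2)},\qquad x\in X(n);$$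 $\mu_1^{(n)}$ is the uniform probability measure on $X(n)$. For $x\in X$ and $g\in S(2n)$ let $c(x;g)=[p_n(x)\cdot g]_n-[p_n(x)]_n$. **Proposition.** Let $z\in\mathbb C\setminus\{0\}$ and $t=|z|^2$. There is a unique probability measure $\mu_t$ on $X$ whose image under $p_n$ is $\mu_t^{(n)}$ for every $n$. There is a unique unitary representation $T_{z,1/2}$ of $S(2\infty)$ in $L^2(X,\mu_t)$ with $$(T_{z,1/2}(g)f)(x)=z^{c(x;g)}f(x\cdot g)\quad\text{for }\mu_t\text{-almost all }x .$$ The constant function $f_0\equiv1$ is an $H$-invariant unit vector of $L^2(X,\mu_t)$. If $z\notin\mathbb Z$, then $f_0$ is also cyclic, i.e. the span of the vectors $T_{z,1/2}(g)f_0$, $g\in S(2\infty)$, is dense. For every $z\neq0$ the function $\varphi_z(g)=(T_{z,1/2}(g)f_0,f_0)$ on $S(2\infty)$ (for $z\notin\mathbb Z$, the spherical function of $T_{z,1/2}$) satisfies, for all $n$ and all $g\in S(2n)$, $$\varphi_z(g)=\left(Reg^n(g)F_z^{(n)},F_z^{(n)}\right)_{L^2(X(n),\mu_1^{(n)})},$$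 where $(Reg^n(g)f)(x)=f(x\cdot g)$ and $$F_z^{(n)}(x)=\left(\frac{1\cdot3\cdots(2n-1)}{t(t+2)\cdots(t+2n-2)}\right)^{1/2}z^{[x]_n},\qquad x\in X(n).$$ -/

import Mathlib

open MeasureTheory MulOpposite

noncomputable section

namespace ZMeasure

/-- The set `{-n, …, -1, 1, …, n}`. -/
abbrev Label (n : ℕ) : Type := {i : ℤ // i ≠ 0 ∧ |i| ≤ (n : ℤ)}

instance (n : ℕ) : Finite (Label n) :=
  Finite.of_injective (fun i : Label n => (⟨i.1, abs_le.1 i.2.2⟩ : Set.Icc (-(n : ℤ)) (n : ℤ)))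
    fun _ _ h => Subtype.ext (congrArg (fun j : Set.Icc (-(n : ℤ)) (n : ℤ) => j.1) h)

/-- The product of the transpositions `(-n, n), …, (-1, 1)`, that is `i ↦ -i`. -/
def flip (n : ℕ) : Equiv.Perm (Label n) where
  toFun i := ⟨-i.1, neg_ne_zero.2 i.2.1, by rw [abs_neg]; exact i.2.2⟩
  invFun i := ⟨-i.1, neg_ne_zero.2 i.2.1, by rw [abs_neg]; exact i.2.2⟩
  left_inv i := Subtype.ext (neg_neg _)
  right_inv i := Subtype.ext (neg_neg _)

/-- The group `S(2n)` of permutations of `{-n, …, -1, 1, …, n}`. Permutations are multiplied from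
left to right (hence the opposite group), so that `(x, g) ↦ x · g`, which moves every pair by `g`,
is a right action. -/
abbrev S (n : ℕ) : Type := (Equiv.Perm (Label n))ᵐᵒᵖ

/-- The hyperoctahedral group `H(n)`: the centralizer of `flip n` in `S(2n)`. -/
def H (n : ℕ) : Subgroup (S n) := Subgroup.centralizer {op (flip n)}

/-- A permutation of `{±1, …, ±n}`, extended by the identity to a permutation of `ℤ`. -/
def extend (n : ℕ) : S n →* (Equiv.Perm ℤ)ᵐᵒᵖ :=
  MonoidHom.op (Equiv.Perm.ofSubtype (p := fun i : ℤ => i ≠ 0 ∧ |i| ≤ (n : ℤ)))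

/-- The group `S(2∞)`, the union of the increasing sequence of the groups `S(2n)`. -/
def SInf : Subgroup (Equiv.Perm ℤ)ᵐᵒᵖ := ⨆ n, (extend n).range

/-- The inclusion of `S(2n)` into `S(2∞)`. -/
def incl (n : ℕ) : S n →* SInf :=
  (extend n).codRestrict SInf fun g => Subgroup.mem_iSup_of_mem n ⟨g, rfl⟩

/-- The group `H = H(∞)`, the union of the increasing sequence of the groups `H(n)`. -/
def HInf : Subgroup SInf := ⨆ n, (H n).map (incl n)

theorem extend_mem {n m : ℕ} (h : n ≤ m) (g : S n) (i : ℤ) :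
    ((extend n g).unop i ≠ 0 ∧ |(extend n g).unop i| ≤ (m : ℤ)) ↔ (i ≠ 0 ∧ |i| ≤ (m : ℤ)) := by
  change ((Equiv.Perm.ofSubtype g.unop) i ≠ 0 ∧ |(Equiv.Perm.ofSubtype g.unop) i| ≤ (m : ℤ)) ↔ _
  by_cases hi : i ≠ 0 ∧ |i| ≤ (n : ℤ)
  · rw [Equiv.Perm.ofSubtype_apply_of_mem g.unop hi]
    have := (g.unop ⟨i, hi⟩).2
    have hnm : (n : ℤ) ≤ m := by exact_mod_cast h
    exact ⟨fun _ => ⟨hi.1, hi.2.trans hnm⟩, fun _ => ⟨this.1, this.2.trans hnm⟩⟩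
  · rw [Equiv.Perm.ofSubtype_apply_of_not_mem g.unop hi]

/-- The inclusion of `S(2n)` into `S(2m)` for `n ≤ m`. -/
def lift {n m : ℕ} (h : n ≤ m) (g : S n) : S m :=
  op ((extend n g).unop.subtypePerm (extend_mem h g))

/-- The set `X(n)` of all partitions of `{-n, …, -1, 1, …, n}` into `n` unordered pairs. A pairing
is recorded as the map that sends every element to the other element of its pair. -/
@[ext] structure X (n : ℕ) where
  /-- The other element of the pair. -/
  mate : Label n → Label n
  mate_mate : ∀ i, mate (mate i) = i
  mate_ne : ∀ i, mate i ≠ i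

instance (n : ℕ) : Finite (X n) := Finite.of_injective X.mate fun _ _ => X.ext

instance (n : ℕ) : Fintype (X n) := Fintype.ofFinite _

instance (n : ℕ) : MeasurableSpace (X n) := ⊤

instance (n : ℕ) : DiscreteMeasurableSpace (X n) := ⟨fun _ => trivial⟩

/-- The right action of `S(2n)` on `X(n)`: the pairs of `x · g` are `{g i, g j}` for the pairs
`{i, j}` of `x`. -/
def act {n : ℕ} (x : X n) (g : S n) : X n where
  mate i := g.unop (x.mate (g.unop.symm i))
  mate_mate i := by simp [x.mate_mate]
  mate_ne i h := x.mate_ne (g.unop.symm i) (by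
    have := congrArg g.unop.symm h
    simpa using this)

/-- The number `[x]_n` of cycles of `x`. The cycles `j₁ → -j₂ → j₂ → -j₃ → ⋯ → -j₁ → j₁` are the
classes of the equivalence relation that is generated by the pairs of `x` and by `{i, -i}`. -/
def cyc {n : ℕ} (x : X n) : ℕ := Nat.card (Quot fun i j : Label n => j = x.mate i ∨ j = flip n i)

theorem abs_eq_of_lt {n : ℕ} {i : Label (n + 1)} (h : ¬ |i.1| ≤ (n : ℤ)) : |i.1| = (n : ℤ) + 1 := by
  have := i.2.2
  push_cast at this
  omega

theorem eq_or_eq_flip {n : ℕ} {i j : Label (n + 1)} (hi : ¬ |i.1| ≤ (n : ℤ))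
    (hj : ¬ |j.1| ≤ (n : ℤ)) : j = i ∨ j = flip (n + 1) i := by
  have := abs_eq_abs.1 ((abs_eq_of_lt hj).trans (abs_eq_of_lt hi).symm)
  exact this.imp Subtype.ext Subtype.ext

theorem abs_flip {n : ℕ} (i : Label n) : |(flip n i).1| = |i.1| := abs_neg _

theorem flip_flip {n : ℕ} (i : Label n) : flip n (flip n i) = i := (flip n).left_inv i

theorem flip_ne {n : ℕ} (i : Label n) : flip n i ≠ i := fun h => by
  have h1 : -i.1 = i.1 := congrArg Subtype.val h
  have := i.2.1
  omega

/-- The element of `{±1, …, ±n}` as an element of `{±1, …, ±(n+1)}`. -/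
def up {n : ℕ} (i : Label n) : Label (n + 1) :=
  ⟨i.1, i.2.1, by have := i.2.2; push_cast; omega⟩

/-- The mate of `i` in the pairing that is obtained from `x` by removing `±(n+1)`: the mate `j` of
`i` in `x` if `j ≠ ±(n+1)`, and otherwise the mate of `-j` in `x`. -/
def derivMate {n : ℕ} (x : X (n + 1)) (i : Label (n + 1)) : Label (n + 1) :=
  if |(x.mate i).1| ≤ (n : ℤ) then x.mate i else x.mate (flip (n + 1) (x.mate i))

theorem derivMate_le {n : ℕ} (x : X (n + 1)) (i : Label (n + 1)) (hi : |i.1| ≤ (n : ℤ)) :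
    |(derivMate x i).1| ≤ (n : ℤ) := by
  unfold derivMate
  split_ifs with h
  · exact h
  · by_contra h2
    rcases eq_or_eq_flip h h2 with h3 | h3
    · have h4 := congrArg x.mate h3
      rw [x.mate_mate, x.mate_mate] at h4
      exact h (by rw [← abs_flip, h4]; exact hi)
    · exact x.mate_ne _ h3

theorem derivMate_derivMate {n : ℕ} (x : X (n + 1)) (i : Label (n + 1)) (hi : |i.1| ≤ (n : ℤ)) :
    derivMate x (derivMate x i) = i := by
  by_cases h : |(x.mate i).1| ≤ (n : ℤ)
  · have h1 : derivMate x i = x.mate i := if_pos h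
    rw [h1]
    unfold derivMate
    rw [x.mate_mate, if_pos hi]
  · have h1 : derivMate x i = x.mate (flip (n + 1) (x.mate i)) := if_neg h
    rw [h1]
    unfold derivMate
    rw [x.mate_mate, if_neg (by rwa [abs_flip]), flip_flip, x.mate_mate]

theorem derivMate_ne {n : ℕ} (x : X (n + 1)) (i : Label (n + 1)) : derivMate x i ≠ i := by
  unfold derivMate
  split_ifs with h
  · exact x.mate_ne i
  · intro h2
    have h3 := congrArg x.mate h2
    rw [x.mate_mate] at h3
    exact flip_ne _ h3

/-- The canonical projection `p_{n,n+1} : X(n+1) → X(n)`. -/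
def proj (n : ℕ) (x : X (n + 1)) : X n where
  mate i := ⟨(derivMate x (up i)).1, (derivMate x (up i)).2.1, derivMate_le x (up i) i.2.2⟩
  mate_mate i := by
    have h := congrArg (fun j : Label (n + 1) => j.1) (derivMate_derivMate x (up i) i.2.2)
    exact Subtype.ext h
  mate_ne i h := derivMate_ne x (up i) <|
    Subtype.ext (show _ = i.1 from congrArg (fun j : Label n => j.1) h)

/-- The projective limit `X` of the sequence `X(n)`. (The index `n` starts at `0`; as `X(0)` has
one point, this changes nothing.) It carries the `σ`-algebra generated by the maps to `X(n)`. -/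
def XInf : Type := {x : (n : ℕ) → X n // ∀ n, proj n (x (n + 1)) = x n}

instance : MeasurableSpace XInf := inferInstanceAs (MeasurableSpace (Subtype _))

/-- The projection `p_n : X → X(n)`. -/
def XInf.p (n : ℕ) (x : XInf) : X n := x.1 n

theorem lift_apply {n m : ℕ} (h : n ≤ m) (g : S n) (i : Label m) :
    ((lift h g).unop i).1 = (extend n g).unop i.1 := rfl

theorem lift_symm_apply {n m : ℕ} (h : n ≤ m) (g : S n) (i : Label m) :
    ((lift h g).unop.symm i).1 = (extend n g).unop.symm i.1 := rfl

theorem lift_self {n : ℕ} (g : S n) : lift le_rfl g = g := by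
  apply unop_injective
  ext i
  rw [lift_apply]
  exact Equiv.Perm.ofSubtype_apply_coe g.unop i

/-- The canonical projection commutes with the action of `S(2n)`. -/
theorem proj_act {n m : ℕ} (h : n ≤ m) (g : S n) (x : X (m + 1)) :
    proj m (act x (lift (h.trans m.le_succ) g)) = act (proj m x) (lift h g) := by
  set G := lift (h.trans m.le_succ) g with hG
  have hn : (n : ℤ) ≤ m := by exact_mod_cast h
  have hfix : ∀ j : Label (m + 1), |(G.unop j).1| ≤ (m : ℤ) ↔ |j.1| ≤ (m : ℤ) := fun j => by
    have h1 := extend_mem h g j.1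
    have h2 := (G.unop j).2.1
    rw [hG, lift_apply] at *
    exact ⟨fun h3 => (h1.1 ⟨h2, h3⟩).2, fun h3 => (h1.2 ⟨j.2.1, h3⟩).2⟩
  have hout : ∀ j : Label (m + 1), ¬ |j.1| ≤ (m : ℤ) → G.unop j = j := fun j hj => by
    apply Subtype.ext
    rw [hG, lift_apply]
    exact Equiv.Perm.ofSubtype_apply_of_not_mem g.unop fun h3 => hj (h3.2.trans hn)
  have key : ∀ i : Label (m + 1), derivMate (act x G) i
      = G.unop (derivMate x (G.unop.symm i)) := fun i => by
    have hm : (act x G).mate i = G.unop (x.mate (G.unop.symm i)) := rfl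
    unfold derivMate
    by_cases hi : |(x.mate (G.unop.symm i)).1| ≤ (m : ℤ)
    · rw [if_pos hi, hm, if_pos ((hfix _).2 hi)]
    · rw [if_neg hi, if_neg (by rw [hm]; exact fun h3 => hi ((hfix _).1 h3))]
      have h4 : (act x G).mate i = x.mate (G.unop.symm i) := hout _ hi
      have h5 : G.unop.symm (flip (m + 1) (x.mate (G.unop.symm i)))
          = flip (m + 1) (x.mate (G.unop.symm i)) := by
        rw [Equiv.symm_apply_eq]
        exact (hout _ (by rwa [abs_flip])).symm
      rw [h4]
      exact congrArg (fun j => G.unop (x.mate j)) h5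
  ext i
  have h1 := congrArg Subtype.val (key (up i))
  have h2 : G.unop.symm (up i) = up ((lift h g).unop.symm i) := Subtype.ext rfl
  rw [h2] at h1
  exact h1

/-- For `x ∈ X` and `g ∈ S(2n)` the sequence `x · g`. Its `k`-th term is `x_k · g` if `k ≥ n`; the
terms below `n` are the successive canonical projections of `x_n · g`. -/
def actSeq {n : ℕ} (x : XInf) (g : S n) (k : ℕ) : X k :=
  if h : n ≤ k then act (x.p k) (lift h g)
  else Nat.decreasingInduction (motive := fun j _ => X j) (fun j _ y => proj j y)
    (act (x.p n) g) (le_of_not_ge h)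

theorem proj_actSeq {n : ℕ} (x : XInf) (g : S n) (k : ℕ) :
    proj k (actSeq x g (k + 1)) = actSeq x g k := by
  unfold actSeq
  by_cases h : n ≤ k
  · rw [dif_pos h, dif_pos (h.trans k.le_succ), proj_act h]
    exact congrArg (fun y => act y (lift h g)) (x.2 k)
  · rw [dif_neg h]
    by_cases h1 : n ≤ k + 1
    · obtain rfl : n = k + 1 := by omega
      rw [dif_pos le_rfl, lift_self]
      exact (Nat.decreasingInduction_succ' (motive := fun j _ => X j) (fun j _ y => proj j y)
        (act (x.p (k + 1)) g)).symm
    · rw [dif_neg h1]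
      exact (Nat.decreasingInduction_succ_left (motive := fun j _ => X j) (fun j _ y => proj j y)
        (act (x.p n) g) (by omega) (le_of_not_ge h)).symm

/-- The right action on `X` of the elements `g ∈ S(2n)` of `S(2∞)`. -/
def actInf {n : ℕ} (x : XInf) (g : S n) : XInf := ⟨actSeq x g, proj_actSeq x g⟩

/-- The fundamental cocycle `c(x; g) = [p_n(x) · g]_n - [p_n(x)]_n` for `g ∈ S(2n)`. -/
def cocycle {n : ℕ} (x : XInf) (g : S n) : ℤ := (cyc (act (x.p n) g) : ℤ) - (cyc (x.p n) : ℤ)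

/-- The measure `μ_t^{(n)}` on `X(n)`:
`μ_t^{(n)}(x) = t ^ [x]_n / (t (t + 2) ⋯ (t + 2n - 2))`. -/
def mu (n : ℕ) (t : ℝ) : Measure (X n) :=
  ∑ x : X n, ENNReal.ofReal (t ^ cyc x / ∏ k ∈ Finset.range n, (t + 2 * k)) • Measure.dirac x

instance (n : ℕ) (t : ℝ) : IsFiniteMeasure (mu n t) := by
  refine ⟨?_⟩
  simp only [mu, Measure.coe_finsetSum, Finset.sum_apply, Measure.smul_apply, smul_eq_mul]
  exact ENNReal.sum_lt_top.2 fun x _ => ENNReal.mul_lt_top ENNReal.ofReal_lt_top (by simp)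

/-- `μ` is the projective limit `μ_t` of the measures `μ_t^{(n)}`. -/
def IsLimitMu (t : ℝ) (μ : Measure XInf) : Prop := ∀ n, μ.map (XInf.p n) = mu n t

/-- `T` is the representation `T_{z,1/2}` of `S(2∞)` in `L²(X, μ)`:
`(T(g) f)(x) = z ^ c(x; g) f(x · g)`. -/
def IsT (z : ℂ) (μ : Measure XInf) (T : SInf →* (Lp ℂ 2 μ ≃ₗᵢ[ℂ] Lp ℂ 2 μ)) : Prop :=
  ∀ (n : ℕ) (g : S n) (f : Lp ℂ 2 μ),
    T (incl n g) f =ᵐ[μ] fun x => z ^ cocycle x g * f (actInf x g)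

/-- The matrix coefficient `g ↦ (T(g) ξ, ξ)` of a unitary representation, which is its spherical
function if `ξ` is a spherical vector. (The inner product of Mathlib is linear in the second
argument.) -/
def matrixCoeff {G E : Type*} [Group G] [NormedAddCommGroup E] [InnerProductSpace ℂ E]
    (T : G →* (E ≃ₗᵢ[ℂ] E)) (ξ : E) (g : G) : ℂ := inner ℂ ξ (T g ξ)

/-- `ξ` is a cyclic vector: the span of the vectors `T(g) ξ` is dense. -/
def IsCyclicVector {G E : Type*} [Group G] [NormedAddCommGroup E] [InnerProductSpace ℂ E]
    (T : G →* (E ≃ₗᵢ[ℂ] E)) (ξ : E) : Prop :=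
  Dense (Submodule.span ℂ (Set.range fun g => T g ξ) : Set E)

/-- A function on `X(n)` as a vector of `L²(X(n), μ_1^{(n)})`. -/
def toL2 {n : ℕ} (f : X n → ℂ) : Lp ℂ 2 (mu n 1) := MemLp.toLp f .of_discrete

/-- The regular representation, `(Reg^n(g) f)(x) = f(x · g)`. -/
def Reg (n : ℕ) (g : S n) (f : X n → ℂ) : X n → ℂ := fun x => f (act x g)

/-- The function
`F_z^{(n)}(x) = ((1 · 3 ⋯ (2n-1)) / (t (t + 2) ⋯ (t + 2n - 2)))^{1/2} z ^ [x]_n` with `t = |z|²`. -/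
def F (n : ℕ) (z : ℂ) (x : X n) : ℂ :=
  (Real.sqrt ((∏ k ∈ Finset.range n, (2 * (k : ℝ) + 1)) /
    ∏ k ∈ Finset.range n, (‖z‖ ^ 2 + 2 * (k : ℝ))) : ℂ) * z ^ cyc x

end ZMeasure

end

/-! A pairing in X(n+1) amounts to its projection to X(n) together with the partner of -(n+1), which
is n+1 or one of the 2n labels ±1, …, ±n (`step`, `code`, `ext_proj_code`). The number of cycles
grows by one in the first case and is unchanged in the others (`cyc_eq`). Hence μ_t is the law of a
chain with independent insertions: the pair {n+1, -(n+1)} is added with probability t/(t+2n), and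
each other choice is made with probability 1/(t+2n).

The group S(2n) fixes ±(m+1) for m ≥ n, so [x·g] - [x] is the same at every level from n on. This
makes c a cocycle on X, and μ_t is quasi-invariant with density t^c = |z^c|²; so f ↦ z^c f(x·g) is
unitary.

For cyclicity, z^{c(x;g)} = z^{-[x]} z^{[x·g]} reduces the claim to level n: the translates of
z^{[x]} must span all functions on X(n) (`cycSpan_eq_top`). The function z^{[x]} on X(n+1) is (z +
J)e, where e extends z^{[x]} by zero from the pairings that contain {n+1, -(n+1)} and J = ∑ (i, n+1)
is a Jucys–Murphy operator (`cycPow_succ`). The eigenvalues of J are integers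
(`jucysMurphy_eigenvalue`), so z + J is invertible when z is not an integer. It preserves the span
of the translates, so e lies in that span. By induction the span contains every function supported
on those pairings, and their translates cover X(n+1). Density of cylinder functions in L² finishes
the argument.

The formula for the matrix coefficient is a finite sum in which t^{[x]} is split as z^{[x]} times
its conjugate. -/

open MeasureTheory MulOpposite

noncomputable section

namespace ZMeasure

/-! ### Integrality of the spectrum of Jucys–Murphy operators -/

section JucysMurphy

variable {α V : Type*} [DecidableEq α] [AddCommGroup V] [Module ℂ V]

/-- The Jucys–Murphy operator `∑ i ∈ A, (i, a)`. -/
def jucysMurphy (ρ : Equiv.Perm α →* Module.End ℂ V) (A : Finset α) (a : α) : Module.End ℂ V :=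
  ∑ i ∈ A, ρ (Equiv.swap i a)

theorem jucysMurphy_conj (ρ : Equiv.Perm α →* Module.End ℂ V) (A : Finset α) (a : α)
    (σ : Equiv.Perm α) :
    ρ σ * jucysMurphy ρ A a = jucysMurphy ρ (A.map σ.toEmbedding) (σ a) * ρ σ := by
  simp only [jucysMurphy, Finset.mul_sum, Finset.sum_mul, Finset.sum_map, ← map_mul]
  refine Finset.sum_congr rfl fun i _ => congrArg ρ ?_
  simp [Equiv.swap_apply_apply]

theorem jucysMurphy_commute (ρ : Equiv.Perm α →* Module.End ℂ V) {A : Finset α} {a : α}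
    {σ : Equiv.Perm α} (ha : σ a = a) (hA : A.map σ.toEmbedding = A) :
    Commute (ρ σ) (jucysMurphy ρ A a) := by
  have h := jucysMurphy_conj ρ A a σ
  rwa [ha, hA] at h

theorem map_swap_eq {A : Finset α} {i j : α} (hi : i ∈ A) (hj : j ∈ A) :
    A.map (Equiv.swap i j).toEmbedding = A := by
  refine Finset.eq_of_subset_of_card_le (fun x hx => ?_) (by simp)
  obtain ⟨y, hy, rfl⟩ := Finset.mem_map.1 hx
  change Equiv.swap i j y ∈ A
  rw [Equiv.swap_apply_def]
  split_ifs <;> assumption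

/-- The eigenvalues of Jucys–Murphy operators are integers. -/
theorem jucysMurphy_eigenvalue [FiniteDimensional ℂ V] (ρ : Equiv.Perm α →* Module.End ℂ V)
    (A : Finset α) : ∀ a ∉ A, ∀ b : ℂ, (jucysMurphy ρ A a).HasEigenvalue b → ∃ k : ℤ, b = k := by
  induction A using Finset.induction_on with
  | empty =>
    intro a _ b hb
    obtain ⟨v, hv⟩ := hb.exists_hasEigenvector
    have h := hv.apply_eq_smul
    simp only [jucysMurphy, Finset.sum_empty, LinearMap.zero_apply] at h
    exact ⟨0, by simpa using (smul_eq_zero.1 h.symm).resolve_right hv.2⟩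
  | insert c A hc ih =>
    intro a ha b hb
    have hca : a ≠ c := fun h => ha (h ▸ Finset.mem_insert_self _ _)
    have haA : a ∉ A := fun h => ha (Finset.mem_insert_of_mem h)
    set s := ρ (Equiv.swap c a) with hs
    have hss : s * s = 1 := by rw [hs, ← map_mul, Equiv.swap_mul_self, map_one]
    set J := jucysMurphy ρ A c with hJ
    set K := jucysMurphy ρ (insert c A) a with hK
    have hmapA : A.map (Equiv.swap c a).toEmbedding = A := by
      refine Finset.eq_of_subset_of_card_le (fun x hx => ?_) (by simp)
      obtain ⟨y, hy, rfl⟩ := Finset.mem_map.1 hx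
      change Equiv.swap c a y ∈ A
      rwa [Equiv.swap_apply_of_ne_of_ne (ne_of_mem_of_not_mem hy hc) (ne_of_mem_of_not_mem hy haA)]
    have hKs : K = s + jucysMurphy ρ A a := Finset.sum_insert hc
    -- The degenerate affine Hecke relation: conjugation by (c, a) turns the sum at a over A into
    -- the sum at c over A.
    have hrel : s * K = 1 + J * s := by
      have h := jucysMurphy_conj ρ A a (Equiv.swap c a)
      rw [hmapA, Equiv.swap_apply_right] at h
      rw [hKs, mul_add, hss, h]
    -- J is a sum of permutations that fix a and preserve `insert c A`, and each of these commutes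
    -- with K.
    have hcomm : Commute J K := by
      rw [hJ, jucysMurphy]
      refine Commute.sum_left _ _ _ fun i hi => jucysMurphy_commute ρ ?_
        (map_swap_eq (Finset.mem_insert_of_mem hi) (Finset.mem_insert_self _ _))
      exact Equiv.swap_apply_of_ne_of_ne (fun h => haA (h ▸ hi)) hca
    have hinv : ∀ v ∈ K.eigenspace b, J v ∈ K.eigenspace b := fun v hv => by
      rw [Module.End.mem_eigenspace_iff] at hv ⊢
      rw [← Module.End.mul_apply, ← hcomm.eq, Module.End.mul_apply, hv, map_smul]
    have : Nontrivial (K.eigenspace b) := (Submodule.nontrivial_iff_ne_bot).2 hb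
    -- This yields a common eigenvector v of J and K; its J-eigenvalue is an integer k by induction.
    obtain ⟨e, he⟩ := Module.End.exists_eigenvalue (J.restrict hinv)
    obtain ⟨⟨v, hvK⟩, hv⟩ := he.exists_hasEigenvector
    have hv0 : v ≠ 0 := fun h => hv.2 (Subtype.ext h)
    have hJv : J v = e • v := congrArg Subtype.val hv.apply_eq_smul
    have hKv : K v = b • v := Module.End.mem_eigenspace_iff.1 hvK
    obtain ⟨k, rfl⟩ := ih c hc e (Module.End.hasEigenvalue_of_hasEigenvector
      ⟨Module.End.mem_eigenspace_iff.2 hJv, hv0⟩)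
    by_cases hbk : b = k
    · exact ⟨k, hbk⟩
    have hJs : J (s v) = b • s v - v := by
      have h := LinearMap.congr_fun hrel v
      simp only [Module.End.mul_apply, LinearMap.add_apply, Module.End.one_apply, hKv,
        map_smul] at h
      rw [h]; abel
    have hd : b - k ≠ 0 := sub_ne_zero.2 hbk
    -- The vector w = s v - (b - k)⁻¹ v satisfies J w = b w. If w ≠ 0, then b is an eigenvalue of J.
    -- If w = 0, then v is an eigenvector of the involution s, so b - k = ±1.
    by_cases hw : s v - (b - k)⁻¹ • v = 0
    · have hsv : s v = (b - k)⁻¹ • v := sub_eq_zero.1 hw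
      have h1 : s (s v) = v := LinearMap.congr_fun hss v
      rw [hsv, map_smul, hsv, smul_smul] at h1
      have h2 : (b - k)⁻¹ * (b - k)⁻¹ = 1 := by
        by_contra hne
        have : ((b - k)⁻¹ * (b - k)⁻¹ - 1) • v = 0 := by rw [sub_smul, h1, one_smul, sub_self]
        exact (smul_eq_zero.1 this).elim (fun h => hne (sub_eq_zero.1 h)) hv0
      rcases mul_self_eq_one_iff.1 h2 with h3 | h3
      · refine ⟨k + 1, ?_⟩
        rw [inv_eq_one] at h3
        push_cast
        linear_combination h3
      · refine ⟨k - 1, ?_⟩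
        rw [inv_eq_iff_eq_inv, inv_neg_one] at h3
        push_cast
        linear_combination h3
    · refine ih c hc b (Module.End.hasEigenvalue_of_hasEigenvector
        ⟨Module.End.mem_eigenspace_iff.2 ?_, hw⟩)
      rw [map_sub, map_smul, hJs, hJv, smul_sub, smul_smul, smul_smul]
      have h4 : b * (b - k)⁻¹ = 1 + (b - k)⁻¹ * k := by field_simp; ring
      rw [h4, add_smul, one_smul]
      abel

end JucysMurphy

/-! ### Splitting the labels of level n+1 into those of level n and ±(n+1) -/

section Labels

variable {n : ℕ}

/-- The label `n + 1`. -/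
def top (n : ℕ) : Label (n + 1) :=
  ⟨(n : ℤ) + 1, by omega, by push_cast; rw [abs_of_nonneg (by omega)]⟩

/-- The label `-(n + 1)`. -/
def bot (n : ℕ) : Label (n + 1) := flip (n + 1) (top n)

theorem flip_top : flip (n + 1) (top n) = bot n := rfl

@[simp] theorem flip_bot : flip (n + 1) (bot n) = top n := flip_flip _

@[simp] theorem flip_up (i : Label n) : flip (n + 1) (up i) = up (flip n i) := rfl

theorem up_le (i : Label n) : |(up i).1| ≤ (n : ℤ) := i.2.2

theorem top_not_le : ¬ |(top n).1| ≤ (n : ℤ) := by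
  change ¬ |(n : ℤ) + 1| ≤ n
  rw [abs_of_nonneg (by omega)]
  omega

theorem bot_not_le : ¬ |(bot n).1| ≤ (n : ℤ) := by
  rw [bot, abs_flip]
  exact top_not_le

theorem up_injective : Function.Injective (up (n := n)) := fun i j h =>
  Subtype.ext (show i.1 = j.1 from congrArg (fun k : Label (n + 1) => k.1) h)

@[simp] theorem up_inj {i j : Label n} : up i = up j ↔ i = j := up_injective.eq_iff

@[simp] theorem up_ne_top (i : Label n) : up i ≠ top n := fun h => top_not_le (h ▸ up_le i)

@[simp] theorem up_ne_bot (i : Label n) : up i ≠ bot n := fun h => bot_not_le (h ▸ up_le i)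

@[simp] theorem top_ne_up (i : Label n) : top n ≠ up i := (up_ne_top i).symm

@[simp] theorem bot_ne_up (i : Label n) : bot n ≠ up i := (up_ne_bot i).symm

@[simp] theorem bot_ne_top : bot n ≠ top n := flip_ne _

@[simp] theorem top_ne_bot : top n ≠ bot n := bot_ne_top.symm

theorem eq_up_or (i : Label (n + 1)) : (∃ j, i = up j) ∨ i = top n ∨ i = bot n := by
  by_cases h : |i.1| ≤ (n : ℤ)
  · exact Or.inl ⟨⟨i.1, i.2.1, h⟩, rfl⟩
  · exact Or.inr (eq_or_eq_flip top_not_le h)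

/-- The element of `{±1, …, ±n}` that is given by a label, if there is one. -/
def down (i : Label (n + 1)) : Option (Label n) :=
  if h : |i.1| ≤ (n : ℤ) then some ⟨i.1, i.2.1, h⟩ else none

@[simp] theorem down_up (i : Label n) : down (up i) = some i := dif_pos (up_le i)

@[simp] theorem down_top : down (top n) = none := dif_neg top_not_le

@[simp] theorem down_bot : down (bot n) = none := dif_neg bot_not_le

end Labels

/-! ### The fibres of the projection X(n+1) → X(n) -/

section Pairings

variable {n : ℕ}

theorem mate_inj (x : X n) {i j : Label n} : x.mate i = x.mate j ↔ i = j :=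
  (Function.Involutive.injective x.mate_mate).eq_iff

theorem mate_eq_comm (x : X n) {i j : Label n} : x.mate i = j ↔ x.mate j = i :=
  ⟨fun h => h ▸ x.mate_mate i, fun h => h ▸ x.mate_mate j⟩

theorem act_mate (x : X n) (g : S n) (i : Label n) :
    (act x g).mate i = g.unop (x.mate (g.unop.symm i)) := rfl

@[simp] theorem act_one (x : X n) : act x 1 = x := rfl

theorem act_mul (x : X n) (g h : S n) : act x (g * h) = act (act x g) h := rfl

theorem up_proj_mate (x : X (n + 1)) (i : Label n) :
    up ((proj n x).mate i) = derivMate x (up i) := rfl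

theorem proj_mate_of_up {x : X (n + 1)} {i j : Label n} (h : x.mate (up i) = up j) :
    (proj n x).mate i = j := by
  apply up_injective
  rw [up_proj_mate, derivMate, h, if_pos (up_le j)]

theorem proj_mate_of_top {x : X (n + 1)} {i : Label n} (h : x.mate (up i) = top n) :
    up ((proj n x).mate i) = x.mate (bot n) := by
  rw [up_proj_mate, derivMate, h, if_neg top_not_le, flip_top]

theorem proj_mate_of_bot {x : X (n + 1)} {i : Label n} (h : x.mate (up i) = bot n) :
    up ((proj n x).mate i) = x.mate (top n) := by
  rw [up_proj_mate, derivMate, h, if_neg bot_not_le, flip_bot]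

/-- The pairing that is obtained by adding the pair `{n + 1, -(n + 1)}`. -/
def emb (y : X n) : X (n + 1) where
  mate i := (down i).elim (flip (n + 1) i) fun j => up (y.mate j)
  mate_mate i := by
    obtain ⟨j, rfl⟩ | rfl | rfl := eq_up_or i <;> simp [flip_top, y.mate_mate]
  mate_ne i := by
    obtain ⟨j, rfl⟩ | rfl | rfl := eq_up_or i <;> simp [flip_top, y.mate_ne]

@[simp] theorem emb_mate_up (y : X n) (i : Label n) : (emb y).mate (up i) = up (y.mate i) := by
  simp [emb]

@[simp] theorem emb_mate_top (y : X n) : (emb y).mate (top n) = bot n := by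
  simp [emb, flip_top]

@[simp] theorem emb_mate_bot (y : X n) : (emb y).mate (bot n) = top n := by
  simp [emb]

open Classical in
/-- The transposition `(i, n + 1)`. -/
def topSwap (i : Label n) : Equiv.Perm (Label (n + 1)) := Equiv.swap (up i) (top n)

/-- The pairings `x ∈ X(n + 1)` with a given projection: `emb y` and its images under the
transpositions `(i, n + 1)`. -/
def step (y : X n) : Option (Label n) → X (n + 1)
  | none => emb y
  | some i => act (emb y) (op (topSwap i))

/-- The mate of `-(n + 1)`, if it is not `n + 1`. -/
def code (x : X (n + 1)) : Option (Label n) := down (x.mate (bot n))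

theorem step_some_mate (y : X n) (i : Label n) (j : Label (n + 1)) :
    (step y (some i)).mate j = topSwap i ((emb y).mate (topSwap i j)) := by
  classical
  simp only [step, act_mate, unop_op, topSwap, Equiv.symm_swap]

@[simp] theorem topSwap_top (i : Label n) : topSwap i (top n) = up i := by
  simp [topSwap]

@[simp] theorem topSwap_bot (i : Label n) : topSwap i (bot n) = bot n := by
  simp [topSwap, Equiv.swap_apply_of_ne_of_ne]

@[simp] theorem topSwap_up_self (i : Label n) : topSwap i (up i) = top n := by
  simp [topSwap]

theorem topSwap_up_of_ne {i j : Label n} (h : j ≠ i) : topSwap i (up j) = up j := by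
  simp [topSwap, Equiv.swap_apply_of_ne_of_ne, h]

@[simp] theorem code_step (y : X n) (o : Option (Label n)) : code (step y o) = o := by
  cases o with
  | none => simp [code, step]
  | some i => simp [code, step_some_mate]

@[simp] theorem proj_step (y : X n) (o : Option (Label n)) : proj n (step y o) = y := by
  ext1
  funext j
  cases o with
  | none => exact proj_mate_of_up (emb_mate_up y j)
  | some i =>
    by_cases hj : j = i
    · subst hj
      apply up_injective
      rw [proj_mate_of_bot (by simp [step_some_mate])]
      simp [step_some_mate, topSwap_up_of_ne (y.mate_ne j)]
    · by_cases hj' : y.mate j = i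
      · apply up_injective
        rw [proj_mate_of_top (by simp [step_some_mate, topSwap_up_of_ne hj, hj'])]
        simp [step_some_mate, hj']
      · exact proj_mate_of_up (by
          simp [step_some_mate, topSwap_up_of_ne hj, topSwap_up_of_ne hj'])

theorem code_eq_none_iff {x : X (n + 1)} : code x = none ↔ x.mate (bot n) = top n := by
  obtain ⟨j, h⟩ | h | h := eq_up_or (x.mate (bot n))
  · simp [code, h]
  · simp [code, h]
  · exact absurd h (x.mate_ne _)

theorem code_eq_some_iff {x : X (n + 1)} {i : Label n} :
    code x = some i ↔ x.mate (bot n) = up i := by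
  obtain ⟨j, h⟩ | h | h := eq_up_or (x.mate (bot n))
  · simp [code, h]
  · simp [code, h]
  · exact absurd h (x.mate_ne _)

theorem mate_bot_eq_of_code_eq {x y : X (n + 1)} (h : code x = code y) :
    x.mate (bot n) = y.mate (bot n) := by
  cases hy : code y with
  | none => rw [code_eq_none_iff.1 hy, code_eq_none_iff.1 (h.trans hy)]
  | some i => rw [code_eq_some_iff.1 hy, code_eq_some_iff.1 (h.trans hy)]

/-- The code gives the partner of -(n+1). The projection then forces the partner of n+1, and the
remaining pairs are those of the projection. -/
theorem ext_proj_code {x y : X (n + 1)} (hp : proj n x = proj n y) (hc : code x = code y) :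
    x = y := by
  have hbot : ∀ {x y : X (n + 1)}, code x = code y → ∀ i, x.mate i = bot n → y.mate i = bot n :=
    fun {x y} hc i hi => by
      rw [mate_eq_comm, ← mate_bot_eq_of_code_eq hc]
      exact (mate_eq_comm x).1 hi
  have htop : ∀ {x y : X (n + 1)}, proj n x = proj n y → code x = code y →
      ∀ i, x.mate i = top n → y.mate i = top n := fun {x y} hp hc i hi => by
    obtain ⟨j, rfl⟩ | rfl | rfl := eq_up_or i
    · have h1 := proj_mate_of_top hi
      obtain ⟨k, hk⟩ | hk | hk := eq_up_or (y.mate (up j))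
      · have h2 := proj_mate_of_up hk
        rw [hp, h2, ← hk, mate_bot_eq_of_code_eq hc, mate_inj] at h1
        exact absurd h1 (up_ne_bot j)
      · exact hk
      · have h3 := hbot hc.symm _ hk
        rw [hi] at h3
        exact absurd h3 top_ne_bot
    · exact absurd hi (x.mate_ne _)
    · rw [← mate_bot_eq_of_code_eq hc, hi]
  have hup : ∀ i : Label n, x.mate (up i) = y.mate (up i) := fun i => by
    obtain ⟨j, hj⟩ | hj | hj := eq_up_or (x.mate (up i))
    · obtain ⟨k, hk⟩ | hk | hk := eq_up_or (y.mate (up i))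
      · rw [hj, hk, ← proj_mate_of_up hj, ← proj_mate_of_up hk, hp]
      · rw [htop hp.symm hc.symm _ hk, hk]
      · rw [hbot hc.symm _ hk, hk]
    · rw [hj, htop hp hc _ hj]
    · rw [hj, hbot hc _ hj]
  ext1
  funext i
  obtain ⟨j, rfl⟩ | rfl | rfl := eq_up_or i
  · exact hup j
  · obtain ⟨j, hj⟩ | hj | hj := eq_up_or (x.mate (top n))
    · rw [hj, eq_comm, mate_eq_comm, ← hup, mate_eq_comm, hj]
    · exact absurd hj (x.mate_ne _)
    · rw [hj, hbot hc _ hj]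
  · exact mate_bot_eq_of_code_eq hc

@[simp] theorem step_proj_code (x : X (n + 1)) : step (proj n x) (code x) = x :=
  ext_proj_code (proj_step _ _) (code_step _ _)

end Pairings

/-! ### Behaviour of the number of cycles under projection and under H(n) -/

section Cycles

variable {n : ℕ}

/-- The adjacency of labels whose classes are the cycles of `x`. -/
abbrev Adj (x : X n) (i j : Label n) : Prop := j = x.mate i ∨ j = flip n i

theorem quot_mate (x : X n) (i : Label n) : Quot.mk (Adj x) (x.mate i) = Quot.mk (Adj x) i :=
  (Quot.sound (r := Adj x) (Or.inl rfl)).symm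

theorem quot_flip (x : X n) (i : Label n) : Quot.mk (Adj x) (flip n i) = Quot.mk (Adj x) i :=
  (Quot.sound (r := Adj x) (Or.inr rfl)).symm

/-- The cycle of `x` that contains a given cycle of the projection of `x`. -/
def quotUp (x : X (n + 1)) : Quot (Adj (proj n x)) → Quot (Adj x) :=
  Quot.lift (fun i => Quot.mk _ (up i)) fun i j h => by
    rcases h with rfl | rfl
    · rw [up_proj_mate, derivMate]
      split_ifs
      · exact (quot_mate x _).symm
      · rw [quot_mate, quot_flip, quot_mate]
    · rw [← flip_up, quot_flip]

/-- The labels ±(n+1) form a cycle of their own, and the other cycles are those of the projection.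
-/
theorem cyc_of_code_none {x : X (n + 1)} (h : code x = none) : cyc x = cyc (proj n x) + 1 := by
  have hb := code_eq_none_iff.1 h
  have ht := (mate_eq_comm x).1 hb
  let e : Quot (Adj x) ≃ Option (Quot (Adj (proj n x))) :=
    { toFun := Quot.lift (fun i => (down i).map (Quot.mk _)) fun i j hij => by
        obtain ⟨k, rfl⟩ | rfl | rfl := eq_up_or i
        · rcases hij with rfl | rfl
          · obtain ⟨l, hl⟩ | hl | hl := eq_up_or (x.mate (up k))
            · rw [hl, ← proj_mate_of_up hl]
              simp [quot_mate]
            · rw [mate_eq_comm, ht] at hl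
              exact absurd hl (bot_ne_up k)
            · rw [mate_eq_comm, hb] at hl
              exact absurd hl (top_ne_up k)
          · simp [quot_flip]
        · rcases hij with rfl | rfl
          · simp [ht]
          · simp [flip_top]
        · rcases hij with rfl | rfl
          · simp [hb]
          · simp
      invFun o := o.elim (Quot.mk _ (top n)) (quotUp x)
      left_inv q := by
        induction q using Quot.ind with | mk i =>
        obtain ⟨k, rfl⟩ | rfl | rfl := eq_up_or i
        · simp [quotUp]
        · simp
        · simp only [down_bot, Option.map_none, Option.elim_none]
          exact (quot_flip x (top n)).symm
      right_inv o := by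
        cases o with
        | none => simp
        | some q =>
          induction q using Quot.ind with | mk i =>
          simp [quotUp] }
  exact (Nat.card_congr e).trans Finite.card_option

/-- Both labels ±(n+1) lie on the cycle of k, which the projection shortens without destroying it.
The inverse of `quotUp` therefore sends both of them to the class of k. -/
theorem cyc_of_code_some {x : X (n + 1)} {k : Label n} (h : code x = some k) :
    cyc x = cyc (proj n x) := by
  have hb := code_eq_some_iff.1 h
  have hk := (mate_eq_comm x).1 hb
  let e : Quot (Adj x) ≃ Quot (Adj (proj n x)) :=
    { toFun := Quot.lift (fun i => (down i).elim (Quot.mk _ k) (Quot.mk _)) fun i j hij => by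
        have htop : ∀ l, x.mate (up l) = top n →
            Quot.mk (Adj (proj n x)) l = Quot.mk (Adj (proj n x)) k := fun l hl => by
          have h1 := proj_mate_of_top hl
          rw [hb, up_inj] at h1
          rw [← h1, quot_mate]
        obtain ⟨l, rfl⟩ | rfl | rfl := eq_up_or i
        · rcases hij with rfl | rfl
          · obtain ⟨m, hm⟩ | hm | hm := eq_up_or (x.mate (up l))
            · rw [hm, ← proj_mate_of_up hm]
              simp [quot_mate]
            · simpa [hm] using htop l hm
            · have h2 := (mate_eq_comm x).1 hm
              rw [hb, up_inj] at h2
              simp [hm, h2]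
          · simp [quot_flip]
        · rcases hij with rfl | rfl
          · obtain ⟨m, hm⟩ | hm | hm := eq_up_or (x.mate (top n))
            · simpa [hm] using (htop m ((mate_eq_comm x).1 hm)).symm
            · simp [hm]
            · simp [hm]
          · simp [flip_top]
        · rcases hij with rfl | rfl
          · simp [hb]
          · simp
      invFun := quotUp x
      left_inv q := by
        have hkb : Quot.mk (Adj x) (up k) = Quot.mk (Adj x) (bot n) := by rw [← hb, quot_mate]
        induction q using Quot.ind with | mk i =>
        obtain ⟨l, rfl⟩ | rfl | rfl := eq_up_or i
        · simp [quotUp]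
        · simpa [quotUp, hkb, flip_top] using quot_flip x (top n)
        · simp [quotUp, hkb]
      right_inv q := by
        induction q using Quot.ind with | mk i =>
        simp [quotUp] }
  exact Nat.card_congr e

/-- A permutation that commutes with i ↦ -i is an isomorphism from the graph of x to the graph of
x·h. -/
theorem cyc_act_of_mem_H (x : X n) {h : S n} (hh : h ∈ H n) : cyc (act x h) = cyc x := by
  have hc : ∀ i, h.unop (flip n i) = flip n (h.unop i) := fun i => by
    have h1 := Subgroup.mem_centralizer_iff.1 hh _ (Set.mem_singleton _)
    exact (congrArg (fun g : S n => g.unop i) h1)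
  refine (Nat.card_congr (Quot.congr h.unop fun i j => ?_)).symm
  simp [act_mate, ← hc]

end Cycles

instance : IsEmpty (Label 0) := ⟨fun i => i.2.1 (abs_nonpos_iff.1 i.2.2)⟩

instance : Unique (X 0) where
  default := ⟨fun i => i, fun i => isEmptyElim i, fun i => isEmptyElim i⟩
  uniq _ := X.ext (funext fun i => isEmptyElim i)

theorem cyc_zero (x : X 0) : cyc x = 0 := by
  have : IsEmpty (Quot (Adj x)) := ⟨fun q => isEmptyElim (Quot.out q)⟩
  exact Nat.card_of_isEmpty

/-! ### Stability of the difference of cycle numbers in the level -/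

section Lift

variable {n m : ℕ}

theorem lift_top (h : n ≤ m) (g : S n) :
    (lift (h.trans m.le_succ) g).unop (top m) = top m := by
  refine Subtype.ext (Equiv.Perm.ofSubtype_apply_of_not_mem g.unop fun h' => top_not_le (n := m) ?_)
  exact h'.2.trans (by exact_mod_cast h)

theorem lift_bot (h : n ≤ m) (g : S n) :
    (lift (h.trans m.le_succ) g).unop (bot m) = bot m := by
  refine Subtype.ext (Equiv.Perm.ofSubtype_apply_of_not_mem g.unop fun h' => bot_not_le (n := m) ?_)
  exact h'.2.trans (by exact_mod_cast h)

theorem code_act_lift (h : n ≤ m) (g : S n) (x : X (m + 1)) :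
    code (act x (lift (h.trans m.le_succ) g)) = none ↔ code x = none := by
  have hb : (lift (h.trans m.le_succ) g).unop.symm (bot m) = bot m := by
    rw [Equiv.symm_apply_eq, lift_bot h]
  rw [code_eq_none_iff, code_eq_none_iff, act_mate, hb]
  nth_rewrite 1 [← lift_top h g]
  exact Equiv.apply_eq_iff_eq _

theorem cyc_eq (x : X (m + 1)) :
    cyc x = cyc (proj m x) + if code x = none then 1 else 0 := by
  cases hx : code x with
  | none => simp [cyc_of_code_none hx]
  | some i => simp [cyc_of_code_some hx]

/-- The pair {m+1, -(m+1)} belongs to x·g exactly if it belongs to x, so both cycle numbers drop by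
the same amount under projection. -/
theorem cyc_act_lift_sub (h : n ≤ m) (g : S n) (x : X (m + 1)) :
    (cyc (act x (lift (h.trans m.le_succ) g)) : ℤ) - cyc x
      = cyc (act (proj m x) (lift h g)) - cyc (proj m x) := by
  rw [cyc_eq (act x _), cyc_eq x, proj_act h, if_congr (code_act_lift h g x) rfl rfl]
  push_cast
  ring

end Lift

/-! ### Translates of z^[x] span all functions on X(n) -/

section Regular

variable {n : ℕ}

theorem code_act_topSwap {x : X (n + 1)} {i : Label n} :
    code (act x (op (topSwap i))) = none ↔ code x = some i := by
  classical
  rw [code_eq_none_iff, code_eq_some_iff, act_mate, unop_op, topSwap, Equiv.symm_swap,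
    ← topSwap, topSwap_bot, ← topSwap_up_self i]
  exact Equiv.apply_eq_iff_eq _

theorem act_topSwap_of_code_some {x : X (n + 1)} {i : Label n} (h : code x = some i) :
    act x (op (topSwap i)) = emb (proj n x) := by
  classical
  conv_lhs => rw [← step_proj_code x, h]
  rw [step, ← act_mul, ← op_mul, topSwap, Equiv.swap_mul_self, op_one, act_one]

/-- The regular representation as a homomorphism to the algebra of operators. -/
def regHom (n : ℕ) : Equiv.Perm (Label n) →* Module.End ℂ (X n → ℂ) where
  toFun σ :=
    { toFun := Reg n (op σ⁻¹)
      map_add' := fun _ _ => rfl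
      map_smul' := fun _ _ => rfl }
  map_one' := rfl
  map_mul' σ τ := by
    ext1 f
    funext x
    change f (act x (op (σ * τ)⁻¹)) = f (act (act x (op σ⁻¹)) (op τ⁻¹))
    rw [← act_mul, ← op_mul, mul_inv_rev]

theorem regHom_apply (σ : Equiv.Perm (Label n)) (f : X n → ℂ) :
    regHom n σ f = Reg n (op σ⁻¹) f := rfl

theorem reg_mul (g h : S n) (f : X n → ℂ) : Reg n (g * h) f = Reg n g (Reg n h f) := rfl

/-- The function `x ↦ z ^ [x]_n`. -/
def cycPow (n : ℕ) (z : ℂ) (x : X n) : ℂ := z ^ cyc x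

/-- The span of the translates of `x ↦ z ^ [x]_n`. -/
def cycSpan (n : ℕ) (z : ℂ) : Submodule ℂ (X n → ℂ) :=
  Submodule.span ℂ (Set.range fun g => Reg n g (cycPow n z))

theorem reg_mem_cycSpan (z : ℂ) (g : S n) {f : X n → ℂ} (hf : f ∈ cycSpan n z) :
    Reg n g f ∈ cycSpan n z := by
  have h : cycSpan n z ≤ (cycSpan n z).comap (regHom n g.unop⁻¹) := by
    refine Submodule.span_le.2 ?_
    rintro _ ⟨k, rfl⟩
    refine Submodule.subset_span ⟨g * k, ?_⟩
    dsimp only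
    rw [regHom_apply, inv_inv, op_unop, reg_mul]
  have h1 : regHom n g.unop⁻¹ f ∈ cycSpan n z := h hf
  rwa [regHom_apply, inv_inv, op_unop] at h1

/-- The extension by zero of a function along `emb`. -/
def embFun (n : ℕ) : (X n → ℂ) →ₗ[ℂ] (X (n + 1) → ℂ) where
  toFun f x := if code x = none then f (proj n x) else 0
  map_add' f f' := by
    funext x
    simp only [Pi.add_apply]
    split_ifs <;> simp
  map_smul' c f := by
    funext x
    simp only [Pi.smul_apply, RingHom.id_apply]
    split_ifs <;> simp

theorem embFun_apply (f : X n → ℂ) (x : X (n + 1)) :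
    embFun n f x = if code x = none then f (proj n x) else 0 := rfl

theorem reg_lift_embFun (g : S n) (f : X n → ℂ) :
    Reg (n + 1) (lift n.le_succ g) (embFun n f) = embFun n (Reg n g f) := by
  funext x
  change embFun n f (act x _) = _
  have h := proj_act le_rfl g x
  rw [lift_self] at h
  rw [embFun_apply, embFun_apply, if_congr (code_act_lift le_rfl g x) rfl rfl, h]
  rfl

/-- Only the i paired with -(n+1) yields a pairing that contains {n+1, -(n+1)}. Hence the
Jucys–Murphy sum applied to `embFun n f` has at most one nonzero term at each x. -/
theorem embFun_act_topSwap (f : X n → ℂ) (x : X (n + 1)) (i : Label n) :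
    embFun n f (act x (op (topSwap i))) = if code x = some i then f (proj n x) else 0 := by
  rw [embFun_apply, if_congr code_act_topSwap rfl rfl]
  split_ifs with h
  · rw [act_topSwap_of_code_some h]
    exact congrArg f (proj_step (proj n x) none)
  · rfl

open Classical in
/-- The Jucys–Murphy operator `∑ i, (i, n + 1)` in the regular representation. -/
def topJM (n : ℕ) : Module.End ℂ (X (n + 1) → ℂ) :=
  have := Fintype.ofFinite (Label n)
  jucysMurphy (regHom (n + 1)) (Finset.univ.map ⟨up, up_injective⟩) (top n)

theorem topJM_eq (n : ℕ) [Fintype (Label n)] (f : X (n + 1) → ℂ) :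
    topJM n f = ∑ i, Reg (n + 1) (op (topSwap i)) f := by
  classical
  rw [topJM, jucysMurphy, Finset.sum_map, LinearMap.sum_apply]
  refine Finset.sum_congr (by ext; simp) fun i _ => ?_
  rw [regHom_apply, Equiv.swap_inv, topSwap]
  congr!

theorem topJM_apply (n : ℕ) [Fintype (Label n)] (f : X (n + 1) → ℂ) (x : X (n + 1)) :
    topJM n f x = ∑ i, f (act x (op (topSwap i))) := by
  rw [topJM_eq, Finset.sum_apply]
  rfl

/-- The scalar z acts on the pairings that contain {n+1, -(n+1)}, and the Jucys–Murphy sum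
contributes a factor 1 on the others; this is the recursion for the number of cycles. -/
theorem cycPow_succ (n : ℕ) (z : ℂ) :
    cycPow (n + 1) z = (algebraMap ℂ (Module.End ℂ (X (n + 1) → ℂ)) z + topJM n) (embFun n (cycPow n z)) := by
  classical
  have := Fintype.ofFinite (Label n)
  funext x
  rw [LinearMap.add_apply, Module.algebraMap_end_apply, Pi.add_apply, Pi.smul_apply, topJM_apply]
  simp only [embFun_act_topSwap]
  rw [embFun_apply, cycPow, cycPow]
  cases hx : code x with
  | none => simp [cyc_of_code_none hx, pow_succ']
  | some i => simp [cyc_of_code_some hx]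

theorem injective_add_topJM {z : ℂ} (hz : ∀ k : ℤ, z ≠ k) (n : ℕ) :
    Function.Injective (algebraMap ℂ (Module.End ℂ (X (n + 1) → ℂ)) z + topJM n) := by
  classical
  rw [injective_iff_map_eq_zero]
  intro v hv
  by_contra hv0
  rw [LinearMap.add_apply, Module.algebraMap_end_apply] at hv
  have h1 : (topJM n).HasEigenvalue (-z) := Module.End.hasEigenvalue_of_hasEigenvector
    ⟨Module.End.mem_eigenspace_iff.2 (by rw [neg_smul]; exact eq_neg_of_add_eq_zero_right hv), hv0⟩
  obtain ⟨k, hk⟩ := jucysMurphy_eigenvalue _ _ _ (by simp) _ h1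
  exact hz (-k) (by push_cast; rw [← hk, neg_neg])

theorem cycSpan_eq_top {z : ℂ} (hz : ∀ k : ℤ, z ≠ k) (n : ℕ) : cycSpan n z = ⊤ := by
  classical
  induction n with
  | zero =>
    refine eq_top_iff.2 fun f _ => ?_
    have hf : f = f default • Reg 0 1 (cycPow 0 z) := by
      funext x
      rw [Unique.eq_default x, Pi.smul_apply, Reg, cycPow, cyc_zero, pow_zero, smul_eq_mul, mul_one]
    rw [hf]
    exact Submodule.smul_mem _ _ (Submodule.subset_span ⟨1, rfl⟩)
  | succ n ih =>
    have := Fintype.ofFinite (Label n)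
    set A := algebraMap ℂ (Module.End ℂ (X (n + 1) → ℂ)) z + topJM n with hA
    have hinv : ∀ f ∈ cycSpan (n + 1) z, A f ∈ cycSpan (n + 1) z := fun f hf => by
      rw [hA, LinearMap.add_apply, Module.algebraMap_end_apply, topJM_eq]
      exact Submodule.add_mem _ (Submodule.smul_mem _ _ hf)
        (Submodule.sum_mem _ fun i _ => reg_mem_cycSpan z _ hf)
    have hinj : Function.Injective (A.restrict hinv) := fun f f' h =>
      Subtype.ext (injective_add_topJM hz n (congrArg Subtype.val h))
    -- In finite dimension the injective A maps the invariant span onto itself. By injectivity on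
    -- the whole space, the preimage w must be `embFun n (cycPow n z)`.
    obtain ⟨⟨w, hw⟩, hw'⟩ := LinearMap.injective_iff_surjective.1 hinj
      ⟨cycPow (n + 1) z, Submodule.subset_span ⟨1, rfl⟩⟩
    have hemb0 : embFun n (cycPow n z) ∈ cycSpan (n + 1) z := by
      have h1 : A w = A (embFun n (cycPow n z)) :=
        (congrArg Subtype.val hw').trans (cycPow_succ n z)
      rwa [← injective_add_topJM hz n h1]
    have hemb : ∀ f, embFun n f ∈ cycSpan (n + 1) z := by
      have h1 : cycSpan n z ≤ (cycSpan (n + 1) z).comap (embFun n) := by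
        refine Submodule.span_le.2 ?_
        rintro _ ⟨g, rfl⟩
        change embFun n (Reg n g _) ∈ cycSpan (n + 1) z
        rw [← reg_lift_embFun]
        exact reg_mem_cycSpan z _ hemb0
      rw [ih] at h1
      exact fun f => h1 Submodule.mem_top
    have hnone : ∀ x : X (n + 1), code x = none → Pi.single x 1 ∈ cycSpan (n + 1) z :=
      fun x hx => by
        convert hemb (Pi.single (proj n x) 1) using 1
        funext y
        rw [embFun_apply, Pi.single_apply, Pi.single_apply]
        by_cases hy : code y = none
        · rw [if_pos hy]
          exact if_congr ⟨congrArg (proj n), fun h => ext_proj_code h (hy.trans hx.symm)⟩ rfl rfl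
        · rw [if_neg hy, if_neg fun h : y = x => hy (h ▸ hx)]
    refine eq_top_iff.2 fun f _ => ?_
    rw [pi_eq_sum_univ' f]
    refine Submodule.sum_mem _ fun x _ => Submodule.smul_mem _ _ ?_
    cases hx : code x with
    | none => exact hnone x hx
    | some i =>
      -- The point mass at x is a translate of the point mass at `emb (proj n x)`.
      have h1 := reg_mem_cycSpan z (op (topSwap i))
        (hnone (emb (proj n x)) (code_step (proj n x) none))
      convert h1 using 1
      funext y
      rw [Reg, Pi.single_apply, Pi.single_apply, ← act_topSwap_of_code_some hx]
      refine if_congr ⟨fun h => h ▸ rfl, fun h => ?_⟩ rfl rfl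
      have h2 := congrArg (fun w => act w (op (topSwap i))⁻¹) h
      simpa only [← act_mul, mul_inv_cancel, act_one] using h2

end Regular

/-! ### Cylinder sets in the projective limit -/

section Limit

theorem exists_p_eq {n m : ℕ} (h : n ≤ m) : ∃ q : X m → X n, ∀ x : XInf, x.p n = q (x.p m) := by
  induction m, h using Nat.le_induction with
  | base => exact ⟨id, fun _ => rfl⟩
  | succ m _ ih =>
    obtain ⟨q, hq⟩ := ih
    exact ⟨q ∘ proj m, fun x => (hq x).trans (congrArg q (x.2 m).symm)⟩

theorem XInf.ext_of_le {x y : XInf} (N : ℕ) (h : ∀ m, N ≤ m → x.p m = y.p m) : x = y := by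
  refine Subtype.ext (funext fun n => ?_)
  obtain ⟨q, hq⟩ := exists_p_eq (le_max_left n N)
  change x.p n = y.p n
  rw [hq x, hq y, h _ (le_max_right n N)]

theorem measurable_p (n : ℕ) : Measurable (XInf.p n) :=
  (measurable_pi_apply n).comp measurable_subtype_coe

theorem measurable_iff_p {α : Type*} [MeasurableSpace α] {f : α → XInf} (N : ℕ)
    (h : ∀ m, N ≤ m → Measurable fun a => (f a).p m) : Measurable f := by
  refine Measurable.subtype_mk (f := fun a n => (f a).p n) (measurable_pi_lambda _ fun n => ?_)
    (h := fun a => (f a).2)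
  obtain ⟨q, hq⟩ := exists_p_eq (le_max_left n N)
  have : (fun a => (f a).p n) = fun a => q ((f a).p (max n N)) := funext fun a => hq _
  rw [this]
  exact (Measurable.of_discrete (f := q)).comp (h _ (le_max_right n N))

/-- The preimages of sets in the finite levels `X(n)`, `N ≤ n`. -/
def cylinders (N : ℕ) : Set (Set XInf) := {s | ∃ n, N ≤ n ∧ ∃ A : Set (X n), XInf.p n ⁻¹' A = s}

theorem isPiSystem_cylinders (N : ℕ) : IsPiSystem (cylinders N) := by
  rintro _ ⟨n, hn, A, rfl⟩ _ ⟨m, hm, B, rfl⟩ _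
  obtain ⟨q, hq⟩ := exists_p_eq (le_max_left n m)
  obtain ⟨r, hr⟩ := exists_p_eq (le_max_right n m)
  refine ⟨max n m, hn.trans (le_max_left n m), q ⁻¹' A ∩ r ⁻¹' B, ?_⟩
  ext x
  simp [hq x, hr x]

theorem generateFrom_cylinders (N : ℕ) :
    (inferInstance : MeasurableSpace XInf) = MeasurableSpace.generateFrom (cylinders N) := by
  apply le_antisymm
  · have h : @Measurable _ _ (MeasurableSpace.generateFrom (cylinders N)) _ (id : XInf → XInf) := by
      refine @measurable_iff_p _ (MeasurableSpace.generateFrom (cylinders N)) _ N fun m hm => ?_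
      exact fun A _ => MeasurableSpace.measurableSet_generateFrom ⟨m, hm, A, rfl⟩
    exact fun s hs => h hs
  · refine MeasurableSpace.generateFrom_le ?_
    rintro _ ⟨n, _, A, rfl⟩
    exact measurable_p n .of_discrete

/-- The threshold N serves the action of g ∈ S(2n), which is computed levelwise only from level n
on. -/
theorem ext_of_cylinders {μ ν : Measure XInf} [IsFiniteMeasure μ] (N : ℕ)
    (h : ∀ m, N ≤ m → ∀ y : X m, μ (XInf.p m ⁻¹' {y}) = ν (XInf.p m ⁻¹' {y})) : μ = ν := by
  have hmap : ∀ m, N ≤ m → ∀ A : Set (X m), μ (XInf.p m ⁻¹' A) = ν (XInf.p m ⁻¹' A) :=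
    fun m hm A => by
      have h1 : μ.map (XInf.p m) = ν.map (XInf.p m) := Measure.ext_iff_singleton.2 fun y => by
        rw [Measure.map_apply (measurable_p m) .of_discrete,
          Measure.map_apply (measurable_p m) .of_discrete, h m hm]
      rw [← Measure.map_apply (measurable_p m) .of_discrete, h1,
        Measure.map_apply (measurable_p m) .of_discrete]
  refine ext_of_generate_finite _ (generateFrom_cylinders N) (isPiSystem_cylinders N) ?_
    (hmap N le_rfl Set.univ)
  rintro _ ⟨m, hm, A, rfl⟩
  exact hmap m hm A

end Limit

/-! ### Existence and uniqueness of μ_t -/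

section LimitMeasure

theorem card_label (n : ℕ) : Nat.card (Label n) = 2 * n := by
  classical
  have h : Nat.card (Label n) = ((Finset.Icc (-(n : ℤ)) n).erase 0).card :=
    Nat.subtype_card _ fun i => by simp [abs_le]
  rw [h, Finset.card_erase_of_mem (by simp), Int.card_Icc]
  omega

/-- The denominator `t (t + 2) ⋯ (t + 2n - 2)`. -/
def den (n : ℕ) (t : ℝ) : ℝ := ∏ k ∈ Finset.range n, (t + 2 * k)

theorem den_pos {t : ℝ} (ht : 0 < t) (n : ℕ) : 0 < den n t :=
  Finset.prod_pos fun k _ => by positivity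

theorem mu_singleton (n : ℕ) (t : ℝ) (x : X n) :
    mu n t {x} = ENNReal.ofReal (t ^ cyc x / den n t) := by
  rw [mu, Measure.finsetSum_apply, Finset.sum_eq_single x]
  · simp [den]
  · intro y _ hy
    simp [hy]
  · simp

theorem IsLimitMu.apply_singleton {t : ℝ} {μ : Measure XInf} (h : IsLimitMu t μ) {n : ℕ}
    (x : X n) : μ (XInf.p n ⁻¹' {x}) = ENNReal.ofReal (t ^ cyc x / den n t) := by
  rw [← Measure.map_apply (measurable_p n) .of_discrete, h n, mu_singleton]

theorem isLimitMu_iff {t : ℝ} {μ : Measure XInf} : IsLimitMu t μ ↔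
    ∀ n (x : X n), μ (XInf.p n ⁻¹' {x}) = ENNReal.ofReal (t ^ cyc x / den n t) :=
  ⟨fun h _ x => h.apply_singleton x, fun h n => Measure.ext_iff_singleton.2 fun x => by
    rw [Measure.map_apply (measurable_p n) .of_discrete, h, mu_singleton]⟩

instance (n : ℕ) : MeasurableSpace (Option (Label n)) := ⊤

instance (n : ℕ) : DiscreteMeasurableSpace (Option (Label n)) := ⟨fun _ => trivial⟩

/-- The transition probabilities from `X(n)` to `X(n + 1)`. -/
def weight (n : ℕ) (t : ℝ) (o : Option (Label n)) : ℝ := o.elim t (fun _ => 1) / (t + 2 * n)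

theorem weight_nonneg {t : ℝ} (ht : 0 < t) (n : ℕ) (o : Option (Label n)) : 0 ≤ weight n t o := by
  cases o <;> simp only [weight, Option.elim_none, Option.elim_some] <;> positivity

theorem sum_weight {t : ℝ} (ht : 0 < t) (n : ℕ) [inst : Fintype (Option (Label n))] :
    ∑ o, weight n t o = 1 := by
  have := Fintype.ofFinite (Label n)
  have h : (Fintype.card (Label n) : ℝ) = 2 * n := by
    rw [← Nat.card_eq_fintype_card, card_label]
    push_cast
    rfl
  have hpos : t + 2 * n ≠ 0 := by positivity
  obtain rfl : inst = instFintypeOption := Subsingleton.elim _ _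
  simp only [weight, ← Finset.sum_div, Fintype.sum_option, Option.elim_none, Option.elim_some,
    Finset.sum_const, Finset.card_univ, nsmul_eq_mul, mul_one, h]
  exact div_self hpos

/-- The transition probability as a measure. -/
def weightMeasure {t : ℝ} (ht : 0 < t) (n : ℕ) : Measure (Option (Label n)) :=
  have := Fintype.ofFinite (Option (Label n))
  (PMF.ofFintype (fun o => ENNReal.ofReal (weight n t o)) (by
    rw [← ENNReal.ofReal_sum_of_nonneg fun o _ => weight_nonneg ht n o, sum_weight ht,
      ENNReal.ofReal_one])).toMeasure

instance {t : ℝ} (ht : 0 < t) (n : ℕ) : IsProbabilityMeasure (weightMeasure ht n) := by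
  unfold weightMeasure
  infer_instance

theorem weightMeasure_singleton {t : ℝ} (ht : 0 < t) (n : ℕ) (o : Option (Label n)) :
    weightMeasure ht n {o} = ENNReal.ofReal (weight n t o) := by
  unfold weightMeasure
  rw [PMF.toMeasure_apply_singleton _ _ .of_discrete]
  rfl

/-- The sequence of pairings that is built from a sequence of insertions. -/
def build (ω : (k : ℕ) → Option (Label k)) : (n : ℕ) → X n
  | 0 => default
  | n + 1 => step (build ω n) (ω n)

/-- The element of `X` that is built from a sequence of insertions. -/
def buildInf (ω : (k : ℕ) → Option (Label k)) : XInf := ⟨build ω, fun _ => proj_step _ _⟩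

theorem measurable_build (n : ℕ) : Measurable fun ω => build ω n := by
  induction n with
  | zero => exact measurable_const
  | succ n ih =>
    have h : Measurable fun p : X n × Option (Label n) => step p.1 p.2 := .of_discrete
    exact h.comp (ih.prodMk (measurable_pi_apply n))

/-- Each pairing comes from exactly one choice of the first n insertions. Every `none` contributes a
factor t and one cycle, and the denominators t + 2k multiply to `den n t`. -/
theorem exists_codes (t : ℝ) (n : ℕ) (x : X n) : ∃ c : (k : ℕ) → Option (Label k),
    (∀ ω, build ω n = x ↔ ∀ k < n, ω k = c k) ∧
      ∏ k ∈ Finset.range n, weight k t (c k) = t ^ cyc x / den n t := by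
  induction n with
  | zero =>
    exact ⟨fun _ => none, fun ω => by simp [Subsingleton.elim (build ω 0) x],
      by simp [den, cyc_zero]⟩
  | succ n ih =>
    obtain ⟨c, hc, hw⟩ := ih (proj n x)
    have hlt : ∀ k < n, Function.update c n (code x) k = c k := fun k hk =>
      Function.update_of_ne hk.ne _ _
    refine ⟨Function.update c n (code x), fun ω => ?_, ?_⟩
    · have h1 : build ω (n + 1) = x ↔ build ω n = proj n x ∧ ω n = code x := by
        constructor
        · rintro rfl
          exact ⟨(proj_step _ _).symm, (code_step _ _).symm⟩
        · rintro ⟨h2, h3⟩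
          rw [build, h2, h3, step_proj_code]
      rw [h1, hc]
      constructor
      · rintro ⟨h2, h3⟩ k hk
        rcases Nat.lt_succ_iff_lt_or_eq.1 hk with h | rfl
        · rw [hlt k h, h2 k h]
        · rw [h3, Function.update_self]
      · intro h
        refine ⟨fun k hk => by rw [h k (hk.trans n.lt_succ_self), hlt k hk], ?_⟩
        rw [h n n.lt_succ_self, Function.update_self]
    · rw [Finset.prod_range_succ, Function.update_self, Finset.prod_congr rfl fun k hk => by
        rw [hlt k (Finset.mem_range.1 hk)], hw, den, den, Finset.prod_range_succ]
      cases hx : code x with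
      | none =>
        rw [cyc_of_code_none hx, weight, Option.elim_none, pow_succ, div_mul_div_comm]
      | some i =>
        rw [cyc_of_code_some hx, weight, Option.elim_some, div_mul_div_comm, mul_one]

theorem exists_limitMu {t : ℝ} (ht : 0 < t) :
    ∃ μ : Measure XInf, IsProbabilityMeasure μ ∧ IsLimitMu t μ := by
  have hm : Measurable buildInf := measurable_iff_p 0 fun m _ => measurable_build m
  -- With independent insertions, the cylinder over x becomes a box whose measure is a product of
  -- weights.
  refine ⟨(Measure.infinitePi (weightMeasure ht)).map buildInf,
    Measure.isProbabilityMeasure_map hm.aemeasurable, isLimitMu_iff.2 fun n x => ?_⟩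
  obtain ⟨c, hc, hw⟩ := exists_codes t n x
  have hset : buildInf ⁻¹' (XInf.p n ⁻¹' {x})
      = Set.pi (Finset.range n : Set ℕ) fun k => {c k} := by
    ext ω
    change build ω n = x ↔ _
    simpa using hc ω
  rw [Measure.map_apply hm (measurable_p n .of_discrete), hset,
    Measure.infinitePi_pi _ fun _ _ => .of_discrete, ← hw,
    ENNReal.ofReal_prod_of_nonneg fun k _ => weight_nonneg ht k _]
  exact Finset.prod_congr rfl fun k _ => weightMeasure_singleton ht k _

theorem existsUnique_limitMu {t : ℝ} (ht : 0 < t) :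
    ∃! μ : Measure XInf, IsProbabilityMeasure μ ∧ IsLimitMu t μ := by
  obtain ⟨μ, hμ, hl⟩ := exists_limitMu ht
  refine ⟨μ, ⟨hμ, hl⟩, fun ν hν => (ext_of_cylinders 0 fun m _ y => ?_).symm⟩
  rw [hl.apply_singleton, hν.2.apply_singleton]

end LimitMeasure

/-! ### The action of S(2∞) on X and the cocycle identity -/

section Action

variable {n m k : ℕ}

theorem extend_injective (n : ℕ) : Function.Injective (extend n) := fun _ _ h =>
  unop_injective (Equiv.Perm.ofSubtype_injective (congrArg unop h))

theorem extend_lift (h : n ≤ m) (g : S n) : extend m (lift h g) = extend n g := by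
  apply unop_injective
  refine Equiv.Perm.ofSubtype_subtypePerm (extend_mem h g) fun i hi => ?_
  by_contra h1
  refine hi (Equiv.Perm.ofSubtype_apply_of_not_mem g.unop fun h2 => h1 ⟨h2.1, h2.2.trans ?_⟩)
  exact_mod_cast h

theorem incl_injective (n : ℕ) : Function.Injective (incl n) := fun _ _ h =>
  extend_injective n (congrArg Subtype.val h)

theorem incl_lift (h : n ≤ m) (g : S n) : incl m (lift h g) = incl n g :=
  Subtype.ext (extend_lift h g)

theorem lift_lift (h : n ≤ m) (h' : m ≤ k) (g : S n) :
    lift h' (lift h g) = lift (h.trans h') g :=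
  incl_injective k (by rw [incl_lift, incl_lift, incl_lift])

theorem lift_one (h : n ≤ m) : lift h (1 : S n) = 1 :=
  incl_injective m (by rw [incl_lift, map_one, map_one])

theorem lift_mul (h : n ≤ m) (g g' : S n) : lift h (g * g') = lift h g * lift h g' :=
  incl_injective m (by rw [incl_lift, map_mul, map_mul, incl_lift, incl_lift])

theorem exists_incl_eq (γ : SInf) : ∃ (n : ℕ) (g : S n), incl n g = γ := by
  have hmono : Monotone fun n => (extend n).range := fun n m h => by
    rintro _ ⟨g, rfl⟩
    exact ⟨lift h g, extend_lift h g⟩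
  obtain ⟨n, g, hg⟩ := (Subgroup.mem_iSup_of_directed hmono.directed_le).1 γ.2
  exact ⟨n, g, Subtype.ext hg⟩

theorem exists_incl_eq_of_le (N : ℕ) (γ : SInf) : ∃ n, N ≤ n ∧ ∃ g : S n, incl n g = γ := by
  obtain ⟨n, g, hg⟩ := exists_incl_eq γ
  exact ⟨max n N, le_max_right n N, lift (le_max_left n N) g, by rw [incl_lift, hg]⟩

theorem exists_incl_eq_and (γ δ : SInf) :
    ∃ (n : ℕ) (g h : S n), incl n g = γ ∧ incl n h = δ := by
  obtain ⟨n, g, hg⟩ := exists_incl_eq γ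
  obtain ⟨m, hnm, h, hh⟩ := exists_incl_eq_of_le n δ
  exact ⟨m, lift hnm g, h, by rw [incl_lift, hg], hh⟩

theorem p_actInf (x : XInf) (g : S n) (h : n ≤ m) :
    (actInf x g).p m = act (x.p m) (lift h g) := dif_pos h

theorem p_actInf_self (x : XInf) (g : S n) : (actInf x g).p n = act (x.p n) g := by
  rw [p_actInf x g le_rfl, lift_self]

theorem actInf_lift (x : XInf) (h : n ≤ m) (g : S n) : actInf x (lift h g) = actInf x g :=
  XInf.ext_of_le m fun k hk => by
    rw [p_actInf _ _ hk, p_actInf _ _ (h.trans hk), lift_lift]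

theorem actInf_one (x : XInf) : actInf x (1 : S n) = x :=
  XInf.ext_of_le n fun k hk => by rw [p_actInf _ _ hk, lift_one, act_one]

theorem actInf_mul (x : XInf) (g h : S n) : actInf x (g * h) = actInf (actInf x g) h :=
  XInf.ext_of_le n fun k hk => by
    rw [p_actInf _ _ hk, p_actInf _ _ hk, p_actInf _ _ hk, lift_mul, act_mul]

theorem cocycle_eq (x : XInf) (g : S n) (h : n ≤ m) :
    cocycle x g = (cyc (act (x.p m) (lift h g)) : ℤ) - cyc (x.p m) := by
  induction m, h using Nat.le_induction with
  | base => rw [lift_self, cocycle]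
  | succ m h ih =>
    have h1 := cyc_act_lift_sub h g (x.p (m + 1))
    rw [h1, ih]
    exact congrArg (fun y => (cyc (act y (lift h g)) : ℤ) - cyc y) (x.2 m).symm

theorem cocycle_lift (x : XInf) (h : n ≤ m) (g : S n) : cocycle x (lift h g) = cocycle x g := by
  rw [cocycle_eq x g h, cocycle]

theorem cocycle_one (x : XInf) : cocycle x (1 : S n) = 0 := by
  rw [cocycle, act_one, sub_self]

theorem cocycle_mul (x : XInf) (g h : S n) :
    cocycle x (g * h) = cocycle x g + cocycle (actInf x g) h := by
  rw [cocycle, cocycle, cocycle, p_actInf_self, act_mul]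
  ring

theorem lift_eq_of_incl_eq {g : S n} {h : S m} (e : incl n g = incl m h) :
    lift (le_max_left n m) g = lift (le_max_right n m) h :=
  incl_injective _ (by rw [incl_lift, incl_lift, e])

theorem actInf_congr {g : S n} {h : S m} (e : incl n g = incl m h) (x : XInf) :
    actInf x g = actInf x h := by
  rw [← actInf_lift x (le_max_left n m), lift_eq_of_incl_eq e, actInf_lift]

theorem cocycle_congr {g : S n} {h : S m} (e : incl n g = incl m h) (x : XInf) :
    cocycle x g = cocycle x h := by
  rw [← cocycle_lift x (le_max_left n m), lift_eq_of_incl_eq e, cocycle_lift]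

theorem measurable_actInf (g : S n) : Measurable fun x => actInf x g :=
  measurable_iff_p n fun m hm => by
    simp only [p_actInf _ g hm]
    exact (Measurable.of_discrete (f := fun y : X m => act y (lift hm g))).comp (measurable_p m)

theorem measurable_cocycle (g : S n) : Measurable fun x => cocycle x g :=
  (Measurable.of_discrete (f := fun y : X n => (cyc (act y g) : ℤ) - cyc y)).comp
    (measurable_p n)

theorem cocycle_of_mem_H {h : S n} (hh : h ∈ H n) (x : XInf) : cocycle x h = 0 := by
  rw [cocycle, cyc_act_of_mem_H _ hh, sub_self]

end Action

/-! ### Quasi-invariance of μ_t -/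

section QuasiInvariance

variable {n : ℕ} {t : ℝ} {μ : Measure XInf}

/-- The density `t ^ c(x; g)`. -/
def density (t : ℝ) (g : S n) (x : XInf) : ENNReal := ENNReal.ofReal (t ^ cocycle x g)

theorem measurable_density (t : ℝ) (g : S n) : Measurable (density t g) :=
  (Measurable.of_discrete (f := fun k : ℤ => ENNReal.ofReal (t ^ k))).comp (measurable_cocycle g)

/-- The preimage of the cylinder over y is the cylinder over y' = y·g⁻¹. There the density is the
constant t^([y]-[y']), which turns the mass proportional to t^[y'] into that of y. -/
theorem measurePreserving_actInf (ht : 0 < t) [IsFiniteMeasure μ] (hμ : IsLimitMu t μ) (g : S n) :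
    MeasurePreserving (fun x => actInf x g) (μ.withDensity (density t g)) μ := by
  refine ⟨measurable_actInf g, (ext_of_cylinders n fun m hm y => ?_).symm⟩
  set G := lift hm g with hG
  set y' := act y G⁻¹ with hy'
  have hyy : act y' G = y := by rw [hy', ← act_mul, inv_mul_cancel, act_one]
  have hset : (fun x => actInf x g) ⁻¹' (XInf.p m ⁻¹' {y}) = XInf.p m ⁻¹' {y'} := by
    ext x
    simp only [Set.mem_preimage, Set.mem_singleton_iff]
    rw [p_actInf x g hm, ← hG]
    constructor
    · rintro rfl
      rw [hy', ← act_mul, mul_inv_cancel, act_one]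
    · intro h
      rw [h, hyy]
  have hmeas : MeasurableSet (XInf.p m ⁻¹' {y'}) := measurable_p m .of_discrete
  have hdens : ∀ x ∈ XInf.p m ⁻¹' {y'},
      density t g x = ENNReal.ofReal (t ^ ((cyc y : ℤ) - cyc y')) := fun x hx => by
    rw [density, cocycle_eq x g hm, ← hG, Set.mem_singleton_iff.1 hx, hyy]
  rw [Measure.map_apply (measurable_actInf g) (measurable_p m .of_discrete), hset,
    withDensity_apply _ hmeas, setLIntegral_congr_fun hmeas hdens, setLIntegral_const,
    hμ.apply_singleton, hμ.apply_singleton, ← ENNReal.ofReal_mul (by positivity),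
    zpow_sub₀ ht.ne', zpow_natCast, zpow_natCast]
  congr 1
  have := (den_pos ht m).ne'
  field_simp

theorem quasiMeasurePreserving_actInf (ht : 0 < t) [IsFiniteMeasure μ] (hμ : IsLimitMu t μ)
    (g : S n) : Measure.QuasiMeasurePreserving (fun x => actInf x g) μ μ := by
  refine ⟨measurable_actInf g, ?_⟩
  have hac : μ ≪ μ.withDensity (density t g) :=
    withDensity_absolutelyContinuous' (measurable_density t g).aemeasurable
      (ae_of_all _ fun x => (ENNReal.ofReal_pos.2 (zpow_pos ht _)).ne')
  have h := hac.map (measurable_actInf g)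
  rwa [(measurePreserving_actInf ht hμ g).map_eq] at h

end QuasiInvariance

/-! ### Construction and uniqueness of the representation -/

section Representation

variable {n : ℕ} {z : ℂ} {μ : Measure XInf}

/-- The function `x ↦ z ^ c(x; g) f(x · g)`. -/
def twist (z : ℂ) (g : S n) (f : XInf → ℂ) (x : XInf) : ℂ := z ^ cocycle x g * f (actInf x g)

theorem measurable_zpow_cocycle (z : ℂ) (g : S n) : Measurable fun x => z ^ cocycle x g :=
  (Measurable.of_discrete (f := fun k : ℤ => z ^ k)).comp (measurable_cocycle g)

theorem twist_ae_congr (hz : z ≠ 0) [IsFiniteMeasure μ] (hμ : IsLimitMu (‖z‖ ^ 2) μ) (g : S n)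
    {f f' : XInf → ℂ} (h : f =ᵐ[μ] f') : twist z g f =ᵐ[μ] twist z g f' := by
  have ht : 0 < ‖z‖ ^ 2 := by positivity
  filter_upwards [(quasiMeasurePreserving_actInf ht hμ g).ae_eq_comp h] with x hx
  exact congrArg (z ^ cocycle x g * ·) hx

theorem twist_mul (hz : z ≠ 0) (g h : S n) (f : XInf → ℂ) :
    twist z (g * h) f = twist z g (twist z h f) := by
  funext x
  rw [twist, twist, twist, cocycle_mul, actInf_mul, zpow_add₀ hz, mul_assoc]

theorem twist_one (f : XInf → ℂ) : twist z (1 : S n) f = f := by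
  funext x
  rw [twist, cocycle_one, actInf_one, zpow_zero, one_mul]

theorem twist_congr {m : ℕ} {g : S n} {h : S m} (e : incl n g = incl m h) :
    twist z g = twist z h := by
  funext f x
  rw [twist, twist, cocycle_congr e, actInf_congr e]

theorem aestronglyMeasurable_twist (hz : z ≠ 0) [IsFiniteMeasure μ] (hμ : IsLimitMu (‖z‖ ^ 2) μ)
    (g : S n) {f : XInf → ℂ} (hf : AEStronglyMeasurable f μ) :
    AEStronglyMeasurable (twist z g f) μ :=
  (measurable_zpow_cocycle z g).aestronglyMeasurable.mul
    (hf.comp_quasiMeasurePreserving (quasiMeasurePreserving_actInf (by positivity) hμ g))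

/-- Since |z^c|² = t^c is the density, this is the change of variables x ↦ x·g. -/
theorem eLpNorm_twist (hz : z ≠ 0) [IsFiniteMeasure μ] (hμ : IsLimitMu (‖z‖ ^ 2) μ) (g : S n)
    {f : XInf → ℂ} (hf : AEStronglyMeasurable f μ) :
    eLpNorm (twist z g f) 2 μ = eLpNorm f 2 μ := by
  have ht : 0 < ‖z‖ ^ 2 := by positivity
  have hmp := measurePreserving_actInf ht hμ g
  rw [← eLpNorm_comp_measurePreserving hf hmp]
  rw [eLpNorm_eq_lintegral_rpow_enorm_toReal (by simp) (by simp),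
    eLpNorm_eq_lintegral_rpow_enorm_toReal (by simp) (by simp)]
  have haem : AEMeasurable (fun x => ‖(f ∘ fun x => actInf x g) x‖ₑ ^ (2 : ENNReal).toReal) μ :=
    (hf.comp_quasiMeasurePreserving
      (quasiMeasurePreserving_actInf ht hμ g)).enorm.pow_const _
  rw [lintegral_withDensity_eq_lintegral_mul₀ (measurable_density _ g).aemeasurable haem]
  congr 1
  refine lintegral_congr fun x => ?_
  rw [Pi.mul_apply, twist, enorm_mul, density]
  simp only [ENNReal.toReal_ofNat, ENNReal.rpow_ofNat, mul_pow, Function.comp_apply]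
  congr 1
  rw [← ofReal_norm, ← ENNReal.ofReal_pow (norm_nonneg _), norm_zpow, ← zpow_natCast, ← zpow_mul,
    ← zpow_natCast ‖z‖, ← zpow_mul, mul_comm]

theorem memLp_twist (hz : z ≠ 0) [IsFiniteMeasure μ] (hμ : IsLimitMu (‖z‖ ^ 2) μ) (g : S n)
    (f : Lp ℂ 2 μ) : MemLp (twist z g f) 2 μ :=
  ⟨aestronglyMeasurable_twist hz hμ g (Lp.aestronglyMeasurable f), by
    rw [eLpNorm_twist hz hμ g (Lp.aestronglyMeasurable f)]
    exact Lp.eLpNorm_lt_top f⟩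

/-- The isometry `f ↦ z ^ c(x; g) f(x · g)` of `L²(X, μ)`. -/
def twistIsometry (hz : z ≠ 0) [IsFiniteMeasure μ] (hμ : IsLimitMu (‖z‖ ^ 2) μ) (g : S n) :
    Lp ℂ 2 μ →ₗᵢ[ℂ] Lp ℂ 2 μ where
  toFun f := (memLp_twist hz hμ g f).toLp _
  map_add' f f' := by
    rw [← MemLp.toLp_add]
    refine MemLp.toLp_congr _ _ ((twist_ae_congr hz hμ g (Lp.coeFn_add f f')).trans ?_)
    exact ae_of_all _ fun x => mul_add _ _ _
  map_smul' c f := by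
    rw [RingHom.id_apply, ← MemLp.toLp_const_smul]
    refine MemLp.toLp_congr _ _ ((twist_ae_congr hz hμ g (Lp.coeFn_smul c f)).trans ?_)
    exact ae_of_all _ fun x => mul_left_comm _ _ _
  norm_map' f := by
    change ‖(memLp_twist hz hμ g f).toLp _‖ = _
    rw [Lp.norm_toLp, eLpNorm_twist hz hμ g (Lp.aestronglyMeasurable f), Lp.norm_def]

theorem coeFn_twistIsometry (hz : z ≠ 0) [IsFiniteMeasure μ] (hμ : IsLimitMu (‖z‖ ^ 2) μ)
    (g : S n) (f : Lp ℂ 2 μ) : twistIsometry hz hμ g f =ᵐ[μ] twist z g f :=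
  MemLp.coeFn_toLp (memLp_twist hz hμ g f)

theorem twistIsometry_congr (hz : z ≠ 0) [IsFiniteMeasure μ] (hμ : IsLimitMu (‖z‖ ^ 2) μ)
    {m : ℕ} {g : S n} {h : S m} (e : incl n g = incl m h) :
    twistIsometry hz hμ g = twistIsometry hz hμ h := by
  ext1 f
  refine MemLp.toLp_congr (memLp_twist hz hμ g f) (memLp_twist hz hμ h f) ?_
  rw [twist_congr e]

theorem twistIsometry_one (hz : z ≠ 0) [IsFiniteMeasure μ] (hμ : IsLimitMu (‖z‖ ^ 2) μ)
    (f : Lp ℂ 2 μ) : twistIsometry hz hμ (1 : S n) f = f :=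
  Lp.ext ((coeFn_twistIsometry hz hμ 1 f).trans (by rw [twist_one]))

theorem twistIsometry_mul (hz : z ≠ 0) [IsFiniteMeasure μ] (hμ : IsLimitMu (‖z‖ ^ 2) μ)
    (g h : S n) (f : Lp ℂ 2 μ) :
    twistIsometry hz hμ (g * h) f = twistIsometry hz hμ g (twistIsometry hz hμ h f) := by
  refine Lp.ext ((coeFn_twistIsometry hz hμ _ f).trans ?_)
  rw [twist_mul hz]
  exact (twist_ae_congr hz hμ g (coeFn_twistIsometry hz hμ h f).symm).trans
    (coeFn_twistIsometry hz hμ g _).symm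

/-- The isometry of `L²(X, μ)` that is given by an element of `S(2∞)`. -/
def repIsometry (hz : z ≠ 0) [IsFiniteMeasure μ] (hμ : IsLimitMu (‖z‖ ^ 2) μ) (γ : SInf) :
    Lp ℂ 2 μ →ₗᵢ[ℂ] Lp ℂ 2 μ :=
  twistIsometry hz hμ (exists_incl_eq γ).choose_spec.choose

/-- The cocycle and the action depend only on the image in S(2∞), so the chosen level and
representative do not matter. -/
theorem repIsometry_incl (hz : z ≠ 0) [IsFiniteMeasure μ] (hμ : IsLimitMu (‖z‖ ^ 2) μ) (g : S n) :
    repIsometry hz hμ (incl n g) = twistIsometry hz hμ g :=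
  twistIsometry_congr hz hμ (exists_incl_eq (incl n g)).choose_spec.choose_spec

theorem repIsometry_one (hz : z ≠ 0) [IsFiniteMeasure μ] (hμ : IsLimitMu (‖z‖ ^ 2) μ)
    (f : Lp ℂ 2 μ) : repIsometry hz hμ 1 f = f := by
  rw [← map_one (incl 0), repIsometry_incl, twistIsometry_one]

theorem repIsometry_mul (hz : z ≠ 0) [IsFiniteMeasure μ] (hμ : IsLimitMu (‖z‖ ^ 2) μ)
    (γ δ : SInf) (f : Lp ℂ 2 μ) :
    repIsometry hz hμ (γ * δ) f = repIsometry hz hμ γ (repIsometry hz hμ δ f) := by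
  obtain ⟨n, g, h, rfl, rfl⟩ := exists_incl_eq_and γ δ
  rw [← map_mul, repIsometry_incl, repIsometry_incl, repIsometry_incl, twistIsometry_mul]

/-- The representation `T_{z,1/2}`. -/
def rep (hz : z ≠ 0) [IsFiniteMeasure μ] (hμ : IsLimitMu (‖z‖ ^ 2) μ) :
    SInf →* (Lp ℂ 2 μ ≃ₗᵢ[ℂ] Lp ℂ 2 μ) where
  toFun γ :=
    { (repIsometry hz hμ γ).toLinearMap with
      invFun := repIsometry hz hμ γ⁻¹
      left_inv := fun f => by
        change repIsometry hz hμ γ⁻¹ (repIsometry hz hμ γ f) = f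
        rw [← repIsometry_mul, inv_mul_cancel, repIsometry_one]
      right_inv := fun f => by
        change repIsometry hz hμ γ (repIsometry hz hμ γ⁻¹ f) = f
        rw [← repIsometry_mul, mul_inv_cancel, repIsometry_one]
      norm_map' := (repIsometry hz hμ γ).norm_map }
  map_one' := LinearIsometryEquiv.ext fun f => repIsometry_one hz hμ f
  map_mul' γ δ := LinearIsometryEquiv.ext fun f => repIsometry_mul hz hμ γ δ f

theorem isT_rep (hz : z ≠ 0) [IsFiniteMeasure μ] (hμ : IsLimitMu (‖z‖ ^ 2) μ) :
    IsT z μ (rep hz hμ) := fun n g f => by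
  have h : rep hz hμ (incl n g) f = twistIsometry hz hμ g f :=
    congrArg (fun T : Lp ℂ 2 μ →ₗᵢ[ℂ] Lp ℂ 2 μ => T f) (repIsometry_incl hz hμ g)
  rw [h]
  exact coeFn_twistIsometry hz hμ g f

theorem existsUnique_isT (hz : z ≠ 0) [IsFiniteMeasure μ] (hμ : IsLimitMu (‖z‖ ^ 2) μ) :
    ∃! T : SInf →* (Lp ℂ 2 μ ≃ₗᵢ[ℂ] Lp ℂ 2 μ), IsT z μ T := by
  refine ⟨rep hz hμ, isT_rep hz hμ, fun T hT => ?_⟩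
  ext1 γ
  ext1 f
  obtain ⟨n, g, rfl⟩ := exists_incl_eq γ
  exact Lp.ext ((hT n g f).trans (isT_rep hz hμ n g f).symm)

end Representation

/-! ### The vector f₀: invariance, cyclicity and matrix coefficients -/

section Spherical

variable {n : ℕ} {z : ℂ} {t : ℝ} {μ : Measure XInf}

theorem IsLimitMu.measurePreserving (hμ : IsLimitMu t μ) (n : ℕ) :
    MeasurePreserving (XInf.p n) μ (mu n t) := ⟨measurable_p n, hμ n⟩

theorem IsLimitMu.memLp_comp (hμ : IsLimitMu t μ) (u : X n → ℂ) :
    MemLp (fun x : XInf => u (x.p n)) 2 μ :=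
  MemLp.comp_measurePreserving (g := u) .of_discrete (hμ.measurePreserving n)

/-- The function `u ∘ p_n` as a vector of `L²(X, μ)`. -/
def cylLp (hμ : IsLimitMu t μ) (n : ℕ) : (X n → ℂ) →ₗ[ℂ] Lp ℂ 2 μ where
  toFun u := (hμ.memLp_comp u).toLp _
  map_add' u v := MemLp.toLp_add (hμ.memLp_comp u) (hμ.memLp_comp v)
  map_smul' c u := MemLp.toLp_const_smul c (hμ.memLp_comp u)

theorem coeFn_cylLp (hμ : IsLimitMu t μ) (u : X n → ℂ) :
    cylLp hμ n u =ᵐ[μ] fun x => u (x.p n) :=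
  MemLp.coeFn_toLp (hμ.memLp_comp u)

theorem IsT.apply_const [IsFiniteMeasure μ] {T : SInf →* (Lp ℂ 2 μ ≃ₗᵢ[ℂ] Lp ℂ 2 μ)}
    (hT : IsT z μ T) (hz : z ≠ 0) (hμ : IsLimitMu (‖z‖ ^ 2) μ) (g : S n) :
    T (incl n g) (Lp.const 2 μ (1 : ℂ)) =ᵐ[μ] fun x => z ^ cocycle x g := by
  refine (hT n g _).trans ((twist_ae_congr hz hμ g (Lp.coeFn_const 2 μ (1 : ℂ))).trans ?_)
  exact ae_of_all _ fun x => mul_one _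

theorem IsT.apply_const_eq [IsFiniteMeasure μ] {T : SInf →* (Lp ℂ 2 μ ≃ₗᵢ[ℂ] Lp ℂ 2 μ)}
    (hT : IsT z μ T) (hz : z ≠ 0) (hμ : IsLimitMu (‖z‖ ^ 2) μ) (g : S n) :
    T (incl n g) (Lp.const 2 μ (1 : ℂ))
      = cylLp hμ n fun y => (cycPow n z y)⁻¹ * Reg n g (cycPow n z) y := by
  refine Lp.ext ((hT.apply_const hz hμ g).trans (Filter.EventuallyEq.trans ?_
    (coeFn_cylLp hμ _).symm))
  refine ae_of_all _ fun x => ?_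
  change z ^ cocycle x g = (z ^ cyc (x.p n))⁻¹ * z ^ cyc (act (x.p n) g)
  rw [cocycle, zpow_sub₀ hz, zpow_natCast, zpow_natCast, div_eq_inv_mul]

theorem norm_const_one [IsProbabilityMeasure μ] : ‖Lp.const 2 μ (1 : ℂ)‖ = 1 := by
  rw [Lp.norm_const _ _ _ (by simp)]
  simp

theorem IsT.apply_const_of_mem_HInf [IsFiniteMeasure μ]
    {T : SInf →* (Lp ℂ 2 μ ≃ₗᵢ[ℂ] Lp ℂ 2 μ)} (hT : IsT z μ T) (hz : z ≠ 0)
    (hμ : IsLimitMu (‖z‖ ^ 2) μ) {h : SInf} (hh : h ∈ HInf) :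
    T h (Lp.const 2 μ (1 : ℂ)) = Lp.const 2 μ (1 : ℂ) := by
  refine Subgroup.iSup_induction _ (C := fun γ => T γ (Lp.const 2 μ (1 : ℂ)) = Lp.const 2 μ (1 : ℂ)) hh
    (fun n γ hγ => ?_) (by rw [map_one]; rfl) fun γ δ hγ hδ => ?_
  · obtain ⟨g, hg, rfl⟩ := hγ
    refine Lp.ext ((hT.apply_const hz hμ g).trans (Filter.EventuallyEq.trans ?_
      (Lp.coeFn_const 2 μ (1 : ℂ)).symm))
    exact ae_of_all _ fun x => by simp [cocycle_of_mem_H hg]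
  · rw [map_mul]
    change T γ (T δ _) = _
    rw [hδ, hγ]

/-- A vector orthogonal to all cylinder functions has integral zero over every cylinder, hence over
every measurable set by the π-λ theorem, so it vanishes. -/
theorem dense_of_cylLp_mem [IsFiniteMeasure μ] (hμ : IsLimitMu t μ)
    {K : Submodule ℂ (Lp ℂ 2 μ)} (hK : ∀ n (u : X n → ℂ), cylLp hμ n u ∈ K) :
    Dense (K : Set (Lp ℂ 2 μ)) := by
  rw [Submodule.dense_iff_topologicalClosure_eq_top, Submodule.topologicalClosure_eq_top_iff,
    Submodule.eq_bot_iff]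
  intro f hf
  have hint : Integrable f μ := (Lp.memLp f).integrable (by norm_num)
  have hcyl : ∀ s ∈ cylinders 0, ∫ x in s, f x ∂μ = 0 := by
    rintro _ ⟨n, -, A, rfl⟩
    have hs : MeasurableSet (XInf.p n ⁻¹' A) := measurable_p n .of_discrete
    rw [← L2.inner_indicatorConstLp_one hs (measure_ne_top μ _) f]
    have h1 : indicatorConstLp 2 hs (measure_ne_top μ _) (1 : ℂ)
        = cylLp hμ n (A.indicator fun _ => 1) :=
      Lp.ext (indicatorConstLp_coeFn.trans (Filter.EventuallyEq.trans
        (ae_of_all _ fun x => by rw [Set.indicator, Set.indicator]; rfl) (coeFn_cylLp hμ _).symm))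
    rw [h1]
    exact (Submodule.mem_orthogonal K f).1 hf _ (hK n _)
  have hall : ∀ s, MeasurableSet s → ∫ x in s, f x ∂μ = 0 := by
    refine MeasurableSpace.induction_on_inter (generateFrom_cylinders 0)
      (isPiSystem_cylinders 0) (by simp) hcyl (fun s hs h => ?_) fun s hd hs h => ?_
    · have h1 := hcyl Set.univ ⟨0, le_rfl, Set.univ, rfl⟩
      rw [setIntegral_univ, ← integral_add_compl hs hint, h, zero_add] at h1
      exact h1
    · rw [integral_iUnion hs hd hint.integrableOn]
      simp [h]
  exact (Lp.eq_zero_iff_ae_eq_zero).2 (Lp.ae_eq_zero_of_forall_setIntegral_eq_zero f (by simp)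
    (by simp) (fun s _ _ => hint.integrableOn) fun s hs _ => hall s hs)

theorem IsT.isCyclicVector [IsFiniteMeasure μ] {T : SInf →* (Lp ℂ 2 μ ≃ₗᵢ[ℂ] Lp ℂ 2 μ)}
    (hT : IsT z μ T) (hz : z ≠ 0) (hμ : IsLimitMu (‖z‖ ^ 2) μ) (hzk : ∀ k : ℤ, z ≠ k) :
    IsCyclicVector T (Lp.const 2 μ (1 : ℂ)) := by
  refine dense_of_cylLp_mem hμ fun n u => ?_
  set K := Submodule.span ℂ (Set.range fun γ => T γ (Lp.const 2 μ (1 : ℂ))) with hKdef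
  -- Division by z^[y] before pulling back to X carries the translate of z^[y] by g to T(g)f₀. As z
  -- ≠ 0, every cylinder function of level n is in the image of M.
  let M : (X n → ℂ) →ₗ[ℂ] Lp ℂ 2 μ :=
    cylLp hμ n ∘ₗ LinearMap.mulLeft ℂ (fun y => (cycPow n z y)⁻¹)
  have hle : cycSpan n z ≤ K.comap M := by
    refine Submodule.span_le.2 ?_
    rintro _ ⟨g, rfl⟩
    exact Submodule.subset_span ⟨incl n g, hT.apply_const_eq hz hμ g⟩
  rw [cycSpan_eq_top hzk] at hle
  have h1 : M (cycPow n z * u) ∈ K := hle Submodule.mem_top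
  have h2 : (fun y => (cycPow n z y)⁻¹) * (cycPow n z * u) = u := by
    funext y
    exact inv_mul_cancel_left₀ (pow_ne_zero _ hz) _
  change cylLp hμ n ((fun y => (cycPow n z y)⁻¹) * (cycPow n z * u)) ∈ K at h1
  rwa [h2] at h1

theorem real_mu_singleton (ht : 0 < t) (x : X n) :
    (mu n t).real {x} = t ^ cyc x / den n t := by
  have := den_pos ht n
  rw [measureReal_def, mu_singleton, ENNReal.toReal_ofReal (by positivity)]

theorem inner_toL2 (f f' : X n → ℂ) :
    inner ℂ (toL2 f) (toL2 f') = ∑ x, ((den n 1)⁻¹ : ℂ) * (f' x * star (f x)) := by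
  rw [L2.inner_def]
  have h : (fun x => inner ℂ (toL2 f x) (toL2 f' x)) =ᵐ[mu n 1] fun x => f' x * star (f x) := by
    filter_upwards [MemLp.coeFn_toLp (f := f) (μ := mu n 1) (p := 2) .of_discrete,
      MemLp.coeFn_toLp (f := f') (μ := mu n 1) (p := 2) .of_discrete] with x h1 h2
    rw [toL2, toL2, h1, h2]
    rfl
  rw [integral_congr_ae h, integral_fintype .of_finite]
  refine Finset.sum_congr rfl fun x _ => ?_
  rw [real_mu_singleton one_pos, one_pow, Complex.real_smul]
  push_cast
  rw [one_div]

theorem IsT.matrixCoeff_eq [IsProbabilityMeasure μ] {T : SInf →* (Lp ℂ 2 μ ≃ₗᵢ[ℂ] Lp ℂ 2 μ)}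
    (hT : IsT z μ T) (hz : z ≠ 0) (hμ : IsLimitMu (‖z‖ ^ 2) μ) (g : S n) :
    matrixCoeff T (Lp.const 2 μ (1 : ℂ)) (incl n g)
      = inner ℂ (toL2 (F n z)) (toL2 (Reg n g (F n z))) := by
  have ht : 0 < ‖z‖ ^ 2 := by positivity
  set u : X n → ℂ := fun y => (cycPow n z y)⁻¹ * Reg n g (cycPow n z) y with hu
  have h : (fun x => inner ℂ (Lp.const 2 μ (1 : ℂ) x) (cylLp hμ n u x))
      =ᵐ[μ] fun x => u (x.p n) := by
    filter_upwards [Lp.coeFn_const 2 μ (1 : ℂ), coeFn_cylLp hμ u] with x h1 h2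
    rw [h1, h2, Function.const_apply, RCLike.inner_apply, map_one, mul_one]
  rw [matrixCoeff, hT.apply_const_eq hz hμ g, inner_toL2, L2.inner_def, integral_congr_ae h,
    ← integral_map (f := u) (measurable_p n).aemeasurable .of_discrete, hμ n,
    integral_fintype .of_finite]
  refine Finset.sum_congr rfl fun y _ => ?_
  have hF : ∀ y, F n z y = (Real.sqrt (den n 1 / den n (‖z‖ ^ 2)) : ℂ) * z ^ cyc y := fun y => by
    rw [F, den, den]
    simp only [add_comm (1 : ℝ)]
  have hd1 := (den_pos one_pos n).ne'
  have hd := den_pos ht n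
  have hsq : (Real.sqrt (den n 1 / den n (‖z‖ ^ 2)) : ℂ) * Real.sqrt (den n 1 / den n (‖z‖ ^ 2))
      = den n 1 / den n (‖z‖ ^ 2) := by
    have := den_pos one_pos n
    rw [← Complex.ofReal_mul, Real.mul_self_sqrt (by positivity), Complex.ofReal_div]
  -- In t^[y] = z^[y] · conj(z)^[y] the first factor cancels z^(-[y]) from T(g)f₀, and the second is
  -- the conjugate factor of F. The factor `den n 1` in the square of the constant of F cancels the
  -- uniform weight.
  have hnorm : ((‖z‖ : ℂ) ^ 2) = z * star z := (Complex.mul_conj' z).symm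
  have huy : u y = (z ^ cyc y)⁻¹ * z ^ cyc (act y g) := rfl
  have hz' : z ^ cyc y ≠ 0 := pow_ne_zero _ hz
  have hd1' : (den n 1 : ℂ) ≠ 0 := Complex.ofReal_ne_zero.2 hd1
  rw [real_mu_singleton ht, Complex.real_smul, huy, Reg, hF, hF, star_mul', star_pow,
    Complex.star_def, Complex.conj_ofReal]
  push_cast
  rw [hnorm, mul_pow]
  change _ = (den n 1 : ℂ)⁻¹ * ((Real.sqrt (den n 1 / den n (‖z‖ ^ 2)) : ℂ)
    * z ^ cyc (act y g) * ((Real.sqrt (den n 1 / den n (‖z‖ ^ 2)) : ℂ) * star z ^ cyc y))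
  rw [show ∀ s a b : ℂ, s * a * (s * b) = s * s * (a * b) by intros; ring, hsq]
  field_simp

end Spherical

end ZMeasure

end

theorem mainTheorem7 (z : ℂ) (hz : z ≠ 0) :
    (∃! μ : Measure ZMeasure.XInf, IsProbabilityMeasure μ ∧ ZMeasure.IsLimitMu (‖z‖ ^ 2) μ) ∧
    ∀ (μ : Measure ZMeasure.XInf) [IsProbabilityMeasure μ], ZMeasure.IsLimitMu (‖z‖ ^ 2) μ →
      (∃! T : ZMeasure.SInf →* (Lp ℂ 2 μ ≃ₗᵢ[ℂ] Lp ℂ 2 μ), ZMeasure.IsT z μ T) ∧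
      ∀ T : ZMeasure.SInf →* (Lp ℂ 2 μ ≃ₗᵢ[ℂ] Lp ℂ 2 μ), ZMeasure.IsT z μ T →
        ‖Lp.const 2 μ (1 : ℂ)‖ = 1 ∧
        (∀ h ∈ ZMeasure.HInf, T h (Lp.const 2 μ (1 : ℂ)) = Lp.const 2 μ (1 : ℂ)) ∧
        ((∀ k : ℤ, z ≠ k) → ZMeasure.IsCyclicVector T (Lp.const 2 μ (1 : ℂ))) ∧
        ∀ (n : ℕ) (g : ZMeasure.S n),
          ZMeasure.matrixCoeff T (Lp.const 2 μ (1 : ℂ)) (ZMeasure.incl n g) =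
            inner ℂ (ZMeasure.toL2 (ZMeasure.F n z))
              (ZMeasure.toL2 (ZMeasure.Reg n g (ZMeasure.F n z))) := by
  have ht : 0 < ‖z‖ ^ 2 := by positivity
  refine ⟨ZMeasure.existsUnique_limitMu ht, fun μ _ hμ =>
    ⟨ZMeasure.existsUnique_isT hz hμ, fun T hT => ⟨ZMeasure.norm_const_one, fun h hh => ?_,
      fun hzk => hT.isCyclicVector hz hμ hzk, fun n g => hT.matrixCoeff_eq hz hμ g⟩⟩⟩
  exact hT.apply_const_of_mem_HInf hz hμ hh
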